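/- **Setting.** A network is a connected, locally finite multigraph $G$ (loops and multiple edges allowed) with marks in a complete separable metric space $\Xi$ on its vertices and on its incident pairs $(v,e)$. Let $\mathcal G,\mathcal G_*,\mathcal G_{**}$ be the sets of isomorphism classes $[G]$, $[G,o]$, $[G,o,v]$ of networks with no, one and two distinguished vertices; $\mathcal G_*$ and $\mathcal G_{**}$ carry the local topology (two rooted networks are close if large balls around the roots are isomorphic with close marks) and its Borel $\sigma$-field. Let $\pi[G,o]=[G]$, let $J=\{B\subseteq\mathcal G:\pi^{-1}(B)\text{ measurable}\}$, and let $I$ be the $\sigma$-field of the measurable $A\subseteq\mathcal G_*$ such that $[G,o]\in A$ implies $[G,v]\in A$ for all $v\in V(G)$. For $g\ge 0$ on $\mathcal G_{**}$ put $g_G(u,v)=g[G,u,v]$, $g^+_G(o)=\sum_{v} g_G(o,v)$ and $g^-_G(o)=\sum_{v} g_G(v,o)$. A random rooted network $[\mathbf G,\mathbf o]$ (a random element of $\mathcal G_*$) is *unimodular* if $E[g^+_{\mathbf G}(\mathbf o)]=E[g^-_{\mathbf G}(\mathbf o)]$ for all measurable $g:\mathcal G_{**}\to\mathbb R^{\ge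 0}$. Write $[\mathbf G]$ for the random element $\pi[\mathbf G,\mathbf o]$ of $(\mathcal G,J)$. A unimodular $[\mathbf G',\mathbf o']$ is a *strong* (respectively *weak*) *unimodularization* of $[\mathbf G]$ if the laws of $[\mathbf G']$ and $[\mathbf G]$ on $(\mathcal G,J)$ are equal (respectively mutually absolutely continuous); $[\mathbf G]$ *can be unimodularized* if it has a weak or strong unimodularization. A *covariant subnetwork* $S$ assigns to every network $G$ a set $S_G\subseteq V(G)$ (and the subnetwork that it induces), compatibly with isomorphisms and such that $\{[G,o]: o\in S_G\}$ is measurable. An *extension* of a unimodular network $[\mathbf G_0,\mathbf o_0]$, whose mark space is a subspace of $\Xi$, is a pair $([\mathbf G,\mathbf o],S)$ such that $\mathbf o\in S_{\mathbf G}$ a.s., $S_{\mathbf G}$ is connected a.s., and $[S_{\mathbf G},\mathbf o]$ has the law of $[\mathbf G_0,\mathbf o_0]$. It is *proper* if $E\big[\sum_{v\in S_{\mathbf G}}g[\mathbf G,\mathbf o,v]\big]=E\big[\sum_{v\in S_{\mathbf G}}g[\mathbf G,v,\mathbf o]\big]$ for all measurable $g:\mathcal G_{**}\to\mathbb R^{\ge0}$.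 **Theorem (Unimodularization of an Extension).** Let $([\mathbf G,\mathbf o],S)$ be a proper extension of a unimodular network. Let $T:\mathcal G_{**}\to\mathbb R^{\ge0}$ be measurable and such that almost surely, for all $v\in V(\mathbf G)$, $T^+_{\mathbf G}(v)=1$ and $T_{\mathbf G}(v,\cdot)\equiv0$ on $V(\mathbf G)\setminus S_{\mathbf G}$. Let $M:=T^-_{\mathbf G}(\mathbf o)\in[0,\infty]$. Then: (i) $[\mathbf G]$ can be unimodularized if and only if $E[M\mid I]<\infty$ a.s. (ii) If $E[M]<\infty$, then $$\mathcal P_T[A]:=\frac1{E[M]}\,E\Big[\sum_{v\in V(\mathbf G)}T_{\mathbf G}(v,\mathbf o)\,1_A[\mathbf G,v]\Big]$$ is a probability measure on $\mathcal G_*$, and it is a weak unimodularization of $[\mathbf G]$. (iii) If $E[M\mid I]<\infty$ a.s., then $$\mathcal P'_T[A]:=E\Big[\frac1{E[M\mid I]}\sum_{v\in V(\mathbf G)}T_{\mathbf G}(v,\mathbf o)\,1_A[\mathbf G,v]\Big]$$ is a probability measure on $\mathcal G_*$, and it is the unique strong unimodularization of $[\mathbf G]$. -/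

import Mathlib

open MeasureTheory Set
open scoped ENNReal NNReal

noncomputable section

namespace RandomNetwork

universe u w

/-- A locally finite (not necessarily connected) multigraph with marks in `Ξ`.  Every edge has an
unordered pair of endpoints (loops and multiple edges are allowed), and marks sit on the vertices
and on the incident pairs `(v, e)`.  As locally finite connected graphs are countable, carriers in
`Type` suffice to represent every isomorphism class of networks. -/
structure MarkedGraph (Ξ : Type u) where
  V : Type
  E : Type
  ends : E → Sym2 V
  vmark : V → Ξ
  emark : ∀ (v : V) (e : E), v ∈ ends e → Ξ
  locallyFinite : ∀ v : V, {e : E | v ∈ ends e}.Finite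

namespace MarkedGraph

variable {Ξ : Type u}

theorem emark_congr (G : MarkedGraph Ξ) {v v' : G.V} {e e' : G.E} (hv : v = v') (he : e = e')
    (h : v ∈ G.ends e) (h' : v' ∈ G.ends e') : G.emark v e h = G.emark v' e' h' := by
  subst hv; subst he; rfl

/-- The simple graph of adjacency of distinct vertices.  It has the same connectedness and the same
graph distance as the multigraph. -/
def simple (G : MarkedGraph Ξ) : SimpleGraph G.V where
  Adj u v := u ≠ v ∧ ∃ e : G.E, G.ends e = s(u, v)
  symm := ⟨fun u v h => ⟨h.1.symm, by
    obtain ⟨e, he⟩ := h.2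
    exact ⟨e, by rw [he, Sym2.eq_swap]⟩⟩⟩
  loopless := ⟨fun _ h => h.1 rfl⟩

theorem mem_ends_of_mem_attachWith {α : Type} {P : α → Prop} (z : Sym2 α) (h : ∀ a ∈ z, P a)
    {v : {a // P a}} (hv : v ∈ z.attachWith h) : v.1 ∈ z := by
  have h1 : v.1 ∈ (z.attachWith h).map Subtype.val := Sym2.mem_map.2 ⟨v, hv, rfl⟩
  rwa [Sym2.attachWith_map_subtypeVal] at h1

/-- The restriction of a marked graph to a set of vertices: all edges with both endpoints in `s`
are kept, and so are the marks. -/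
def induce (G : MarkedGraph Ξ) (s : Set G.V) : MarkedGraph Ξ where
  V := {v : G.V // v ∈ s}
  E := {e : G.E // ∀ v ∈ G.ends e, v ∈ s}
  ends e := (G.ends e.1).attachWith e.2
  vmark v := G.vmark v.1
  emark v e h := G.emark v.1 e.1 (mem_ends_of_mem_attachWith _ _ h)
  locallyFinite v := by
    refine Set.Finite.subset
      ((G.locallyFinite v.1).preimage (Subtype.val_injective.injOn)) ?_
    intro e he
    exact mem_ends_of_mem_attachWith _ _ he

/-- An isomorphism of the underlying multigraphs. -/
structure GraphEquiv (G H : MarkedGraph Ξ) where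
  vertex : G.V ≃ H.V
  edge : G.E ≃ H.E
  ends_edge : ∀ e : G.E, H.ends (edge e) = (G.ends e).map vertex

namespace GraphEquiv

/-- A multigraph isomorphism that preserves all the marks, that is, a network isomorphism. -/
def PreservesMarks {G H : MarkedGraph Ξ} (φ : GraphEquiv G H) : Prop :=
  (∀ v : G.V, H.vmark (φ.vertex v) = G.vmark v) ∧
  ∀ (v : G.V) (e : G.E) (h : v ∈ G.ends e) (h' : φ.vertex v ∈ H.ends (φ.edge e)),
    H.emark (φ.vertex v) (φ.edge e) h' = G.emark v e h

/-- Corresponding marks are at distance less than `ε`. -/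
def MarksWithin [MetricSpace Ξ] {G H : MarkedGraph Ξ} (φ : GraphEquiv G H) (ε : ℝ) : Prop :=
  (∀ v : G.V, dist (H.vmark (φ.vertex v)) (G.vmark v) < ε) ∧
  ∀ (v : G.V) (e : G.E) (h : v ∈ G.ends e) (h' : φ.vertex v ∈ H.ends (φ.edge e)),
    dist (H.emark (φ.vertex v) (φ.edge e) h') (G.emark v e h) < ε

theorem vertex_mem {G H : MarkedGraph Ξ} (φ : GraphEquiv G H) {v : G.V} {e : G.E}
    (h : v ∈ G.ends e) : φ.vertex v ∈ H.ends (φ.edge e) := by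
  rw [φ.ends_edge]; exact Sym2.mem_map.2 ⟨v, h, rfl⟩

def refl (G : MarkedGraph Ξ) : GraphEquiv G G :=
  ⟨Equiv.refl _, Equiv.refl _, fun e => by simp⟩

def symm {G H : MarkedGraph Ξ} (φ : GraphEquiv G H) : GraphEquiv H G :=
  ⟨φ.vertex.symm, φ.edge.symm, fun e => by
    obtain ⟨e, rfl⟩ := φ.edge.surjective e
    rw [φ.ends_edge, Sym2.map_map]; simp⟩

def trans {G H K : MarkedGraph Ξ} (φ : GraphEquiv G H) (ψ : GraphEquiv H K) : GraphEquiv G K :=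
  ⟨φ.vertex.trans ψ.vertex, φ.edge.trans ψ.edge, fun e => by
    simp [ψ.ends_edge, φ.ends_edge, Sym2.map_map]⟩

theorem PreservesMarks.refl (G : MarkedGraph Ξ) : (GraphEquiv.refl G).PreservesMarks :=
  ⟨fun _ => rfl, fun _ _ _ _ => rfl⟩

theorem PreservesMarks.symm {G H : MarkedGraph Ξ} {φ : GraphEquiv G H} (hφ : φ.PreservesMarks) :
    φ.symm.PreservesMarks := by
  refine ⟨fun v => ?_, fun v e h h' => ?_⟩
  · obtain ⟨v, rfl⟩ := φ.vertex.surjective v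
    rw [hφ.1]; exact congrArg G.vmark (φ.vertex.symm_apply_apply v)
  · have h2 := hφ.2 _ _ h' (φ.vertex_mem h')
    rw [← h2]
    exact H.emark_congr (φ.vertex.apply_symm_apply v) (φ.edge.apply_symm_apply e) _ _

theorem PreservesMarks.trans {G H K : MarkedGraph Ξ} {φ : GraphEquiv G H} {ψ : GraphEquiv H K}
    (hφ : φ.PreservesMarks) (hψ : ψ.PreservesMarks) : (φ.trans ψ).PreservesMarks :=
  ⟨fun v => (hψ.1 _).trans (hφ.1 v),
    fun v e h h' => (hψ.2 _ _ (φ.vertex_mem h) h').trans (hφ.2 v e h _)⟩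

end GraphEquiv

/-- Transport of the marks along a map of mark spaces. -/
def mapMarks {Ξ' : Type w} (f : Ξ → Ξ') (G : MarkedGraph Ξ) : MarkedGraph Ξ' where
  V := G.V
  E := G.E
  ends := G.ends
  vmark v := f (G.vmark v)
  emark v e h := f (G.emark v e h)
  locallyFinite := G.locallyFinite

end MarkedGraph

/-- A network: a connected locally finite marked multigraph. -/
structure Network (Ξ : Type u) extends MarkedGraph Ξ where
  connected : toMarkedGraph.simple.Connected

/-- Isomorphism of networks. -/
instance networkSetoid (Ξ : Type u) : Setoid (Network Ξ) where
  r G H := ∃ φ : MarkedGraph.GraphEquiv G.toMarkedGraph H.toMarkedGraph, φ.PreservesMarks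
  iseqv :=
    { refl := fun G => ⟨_, MarkedGraph.GraphEquiv.PreservesMarks.refl G.toMarkedGraph⟩
      symm := fun ⟨_, h⟩ => ⟨_, h.symm⟩
      trans := fun ⟨_, h⟩ ⟨_, h'⟩ => ⟨_, h.trans h'⟩ }

/-- The set `𝒢` of isomorphism classes `[G]` of networks. -/
def NetClass (Ξ : Type u) := Quotient (networkSetoid Ξ)

/-- A network with an ordered `n`-tuple of distinguished vertices (roots). -/
structure RootedNetwork (Ξ : Type u) (n : ℕ) where
  net : Network Ξ
  root : Fin n → net.V

/-- Isomorphism of networks with `n` roots. -/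
instance rootedSetoid (Ξ : Type u) (n : ℕ) : Setoid (RootedNetwork Ξ n) where
  r X Y := ∃ φ : MarkedGraph.GraphEquiv X.net.toMarkedGraph Y.net.toMarkedGraph,
    φ.PreservesMarks ∧ ∀ i, φ.vertex (X.root i) = Y.root i
  iseqv :=
    { refl := fun X => ⟨_, MarkedGraph.GraphEquiv.PreservesMarks.refl X.net.toMarkedGraph,
        fun _ => rfl⟩
      symm := fun ⟨φ, h, hr⟩ => ⟨_, h.symm, fun i => by
        rw [← hr i]; exact φ.vertex.symm_apply_apply _⟩
      trans := fun ⟨φ, h, hr⟩ ⟨ψ, h', hr'⟩ => ⟨_, h.trans h', fun i => by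
        rw [← hr' i, ← hr i]; rfl⟩ }

/-- Isomorphism classes of networks with `n` roots. -/
def RootedClass (Ξ : Type u) (n : ℕ) := Quotient (rootedSetoid Ξ n)

/-- The space `𝒢_*` of isomorphism classes `[G, o]` of rooted networks. -/
abbrev NetStar (Ξ : Type u) := RootedClass Ξ 1

/-- The space `𝒢_**` of isomorphism classes `[G, o, v]` of doubly-rooted networks. -/
abbrev NetStarStar (Ξ : Type u) := RootedClass Ξ 2

variable {Ξ : Type u}

/-- The class `[G, o₁, …, oₙ]`. -/
def cls {n : ℕ} (G : Network Ξ) (o : Fin n → G.V) : RootedClass Ξ n :=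
  Quotient.mk (rootedSetoid Ξ n) ⟨G, o⟩

theorem cls_eq_of_equiv {n : ℕ} {G H : Network Ξ}
    {φ : MarkedGraph.GraphEquiv G.toMarkedGraph H.toMarkedGraph} (hφ : φ.PreservesMarks)
    (o : Fin n → G.V) (o' : Fin n → H.V) (h : ∀ i, φ.vertex (o i) = o' i) :
    cls G o = cls H o' :=
  Quotient.sound (s := rootedSetoid Ξ n) ⟨φ, hφ, h⟩

/-! ### Topology and Borel sigma-field -/

/-- The vertices at graph distance at most `r` from one of the roots. -/
def ball {n : ℕ} (X : RootedNetwork Ξ n) (r : ℕ) : Set X.net.V :=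
  {v | ∃ i, X.net.simple.dist (X.root i) v ≤ r}

theorem root_mem_ball {n : ℕ} (X : RootedNetwork Ξ n) (r : ℕ) (i : Fin n) :
    X.root i ∈ ball X r :=
  ⟨i, by simp⟩

/-- `Y` looks like `X` up to distance `r` with precision `ε`: there is a root-preserving
isomorphism between the subgraphs induced on the `r`-balls around the roots, such that
corresponding marks are at distance less than `ε`. -/
def LocallyClose [MetricSpace Ξ] {n : ℕ} (X Y : RootedNetwork Ξ n) (r : ℕ) (ε : ℝ) : Prop :=
  ∃ φ : MarkedGraph.GraphEquiv (X.net.toMarkedGraph.induce (ball X r))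
      (Y.net.toMarkedGraph.induce (ball Y r)),
    φ.MarksWithin ε ∧
    ∀ i, φ.vertex ⟨X.root i, root_mem_ball X r i⟩ = ⟨Y.root i, root_mem_ball Y r i⟩

/-- The local topology, generated by the neighbourhoods
`{[Y] | Y looks like X up to distance r with precision ε}`.  It is the topology of the usual local
metric, in which two classes are at distance at most `1 / (1 + r)` when they look alike up to
distance `r` with precision `1 / r`. -/
instance [MetricSpace Ξ] (n : ℕ) : TopologicalSpace (RootedClass Ξ n) :=
  TopologicalSpace.generateFrom
    {U | ∃ (X : RootedNetwork Ξ n) (r : ℕ) (ε : ℝ), 0 < ε ∧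
      U = {y | ∃ Y : RootedNetwork Ξ n, cls Y.net Y.root = y ∧ LocallyClose X Y r ε}}

instance [MetricSpace Ξ] (n : ℕ) : MeasurableSpace (RootedClass Ξ n) := borel _

instance [MetricSpace Ξ] (n : ℕ) : BorelSpace (RootedClass Ξ n) := ⟨rfl⟩

/-- Forgetting or rearranging roots: `[G, (oᵢ)ᵢ] ↦ [G, (o_{f j})ⱼ]`. -/
def select {n m : ℕ} (f : Fin m → Fin n) : RootedClass Ξ n → RootedClass Ξ m :=
  Quotient.lift (fun X : RootedNetwork Ξ n => cls X.net (fun j => X.root (f j))) (by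
    rintro X Y ⟨φ, hφ, hr⟩
    exact cls_eq_of_equiv hφ _ _ (fun j => hr (f j)))

/-- `π₁ [G, o, v] = [G, o]`. -/
def proj₁ : NetStarStar Ξ → NetStar Ξ := select ![0]

/-- `π₂ [G, o, v] = [G, v]`. -/
def proj₂ : NetStarStar Ξ → NetStar Ξ := select ![1]

/-- `π [G, o] = [G]`. -/
def unroot : NetStar Ξ → NetClass Ξ :=
  Quotient.lift (fun X : RootedNetwork Ξ 1 => Quotient.mk (networkSetoid Ξ) X.net) (by
    rintro X Y ⟨φ, hφ, _⟩
    exact Quotient.sound (s := networkSetoid Ξ) ⟨φ, hφ⟩)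

/-- The sigma-field `J = {B | π⁻¹ B is measurable}` on `𝒢`. -/
instance [MetricSpace Ξ] : MeasurableSpace (NetClass Ξ) :=
  MeasurableSpace.map (unroot (Ξ := Ξ)) inferInstance

/-- The invariant sigma-field `I` on `𝒢_*`: the events that are closed under changes of the
root. -/
@[reducible] def invariantField (Ξ : Type u) [MetricSpace Ξ] : MeasurableSpace (NetStar Ξ) where
  MeasurableSet' A := MeasurableSet A ∧
    ∀ (G : Network Ξ) (o v : G.V), cls G ![o] ∈ A → cls G ![v] ∈ A
  measurableSet_empty := ⟨MeasurableSet.empty, fun _ _ _ h => h⟩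
  measurableSet_compl A hA := ⟨hA.1.compl, fun G o v h h' => h (hA.2 G v o h')⟩
  measurableSet_iUnion f hf := ⟨MeasurableSet.iUnion fun i => (hf i).1, fun G o v h => by
    obtain ⟨i, hi⟩ := Set.mem_iUnion.1 h
    exact Set.mem_iUnion.2 ⟨i, (hf i).2 G o v hi⟩⟩

/-! ### Mass transport -/

/-- `g⁺ [G, o] = ∑_v g [G, o, v]`, the mass sent by the root. -/
def outSum (g : NetStarStar Ξ → ℝ≥0∞) : NetStar Ξ → ℝ≥0∞ :=
  Quotient.lift (fun X : RootedNetwork Ξ 1 => ∑' v : X.net.V, g (cls X.net ![X.root 0, v])) (by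
    rintro X Y ⟨φ, hφ, hr⟩
    show ∑' v : X.net.V, g (cls X.net ![X.root 0, v])
      = ∑' v : Y.net.V, g (cls Y.net ![Y.root 0, v])
    rw [← φ.vertex.tsum_eq (fun v => g (cls Y.net ![Y.root 0, v]))]
    refine tsum_congr fun v => congrArg g (cls_eq_of_equiv hφ _ _ fun i => ?_)
    fin_cases i
    · exact hr 0
    · rfl)

/-- `g⁻ [G, o] = ∑_v g [G, v, o]`, the mass received by the root. -/
def inSum (g : NetStarStar Ξ → ℝ≥0∞) : NetStar Ξ → ℝ≥0∞ :=
  Quotient.lift (fun X : RootedNetwork Ξ 1 => ∑' v : X.net.V, g (cls X.net ![v, X.root 0])) (by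
    rintro X Y ⟨φ, hφ, hr⟩
    show ∑' v : X.net.V, g (cls X.net ![v, X.root 0])
      = ∑' v : Y.net.V, g (cls Y.net ![v, Y.root 0])
    rw [← φ.vertex.tsum_eq (fun v => g (cls Y.net ![v, Y.root 0]))]
    refine tsum_congr fun v => congrArg g (cls_eq_of_equiv hφ _ _ fun i => ?_)
    fin_cases i
    · rfl
    · exact hr 0)

/-- Unimodularity of the law `μ` of a random rooted network: the mass transport principle
`E[g⁺(o)] = E[g⁻(o)]` for all measurable `g : 𝒢_** → ℝ≥0`. -/
def Unimodular [MetricSpace Ξ] (μ : Measure (NetStar Ξ)) : Prop :=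
  ∀ g : NetStarStar Ξ → ℝ≥0, Measurable g →
    ∫⁻ x, outSum (fun z => (g z : ℝ≥0∞)) x ∂μ = ∫⁻ x, inSum (fun z => (g z : ℝ≥0∞)) x ∂μ

/-- A covariant subset of the vertices: a set `S_G` of vertices of every network `G`, compatible
with isomorphisms, such that `{[G, o] | o ∈ S_G}` is measurable. -/
structure CovariantSubset (Ξ : Type u) [MetricSpace Ξ] where
  verts : ∀ G : Network Ξ, Set G.V
  covariant : ∀ (G H : Network Ξ) (φ : MarkedGraph.GraphEquiv G.toMarkedGraph H.toMarkedGraph),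
    φ.PreservesMarks → ∀ v : G.V, φ.vertex v ∈ verts H ↔ v ∈ verts G
  measurable_verts :
    MeasurableSet {x : NetStar Ξ | ∃ (G : Network Ξ) (o : G.V), cls G ![o] = x ∧ o ∈ verts G}

/-- The event `{[G, o] | o ∈ S_G}`. -/
def CovariantSubset.event [MetricSpace Ξ] (S : CovariantSubset Ξ) : Set (NetStar Ξ) :=
  {x | ∃ (G : Network Ξ) (o : G.V), cls G ![o] = x ∧ o ∈ S.verts G}

/-- `∑_{v ∈ S_G} g [G, o, v]`. -/
def outSumOn [MetricSpace Ξ] (S : CovariantSubset Ξ) (g : NetStarStar Ξ → ℝ≥0∞) :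
    NetStar Ξ → ℝ≥0∞ :=
  outSum ((proj₂ ⁻¹' S.event).indicator g)

/-- `∑_{v ∈ S_G} g [G, v, o]`. -/
def inSumOn [MetricSpace Ξ] (S : CovariantSubset Ξ) (g : NetStarStar Ξ → ℝ≥0∞) :
    NetStar Ξ → ℝ≥0∞ :=
  inSum ((proj₁ ⁻¹' S.event).indicator g)

/-! ### Extensions -/

/-- Transport of marks on networks. -/
def Network.mapMarks {Ξ' : Type w} (f : Ξ → Ξ') (G : Network Ξ) : Network Ξ' where
  toMarkedGraph := G.toMarkedGraph.mapMarks f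
  connected := G.connected

/-- A rooted network with marks in `Ξ`, viewed as one with marks in `Ξ'` through `f : Ξ → Ξ'`. -/
def mapMarks {Ξ' : Type w} (f : Ξ → Ξ') : NetStar Ξ → NetStar Ξ' :=
  Quotient.lift (fun X : RootedNetwork Ξ 1 => cls (X.net.mapMarks f) X.root) (by
    rintro X Y ⟨φ, hφ, hr⟩
    exact cls_eq_of_equiv (G := X.net.mapMarks f) (H := Y.net.mapMarks f)
      (φ := ⟨φ.vertex, φ.edge, φ.ends_edge⟩)
      ⟨fun v => congrArg f (hφ.1 v), fun v e h h' => congrArg f (hφ.2 v e h h')⟩ _ _ hr)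

/-- `([G, o], S)`, where `[G, o]` has law `μ`, is an extension of the random rooted network
`[G₀, o₀]` with law `μ₀`.  The mark space `Ξ₀` of `G₀` is a part of the mark space `Ξ` of `G`,
through the embedding `ι`. -/
structure IsExtension {Ξ₀ : Type w} [MetricSpace Ξ₀] [MetricSpace Ξ] (ι : Ξ₀ → Ξ)
    (μ₀ : Measure (NetStar Ξ₀)) (μ : Measure (NetStar Ξ)) (S : CovariantSubset Ξ) : Prop where
  /-- Almost surely `o ∈ S_G`. -/
  root_mem : ∀ᵐ x ∂μ, ∀ (G : Network Ξ) (o : G.V), cls G ![o] = x → o ∈ S.verts G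
  /-- Almost surely the subnetwork `S_G` is connected. -/
  connected : ∀ᵐ x ∂μ, ∀ (G : Network Ξ) (o : G.V), cls G ![o] = x →
    (G.toMarkedGraph.induce (S.verts G)).simple.Connected
  /-- `[S_G, o]` has the same distribution as `[G₀, o₀]`. -/
  law_eq : ∀ A : Set (NetStar Ξ), MeasurableSet A →
    μ {x | ∃ (G : Network Ξ) (o : G.V) (ho : o ∈ S.verts G)
        (hc : (G.toMarkedGraph.induce (S.verts G)).simple.Connected),
        cls G ![o] = x ∧ cls ⟨G.toMarkedGraph.induce (S.verts G), hc⟩ ![⟨o, ho⟩] ∈ A}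
      = μ₀ (mapMarks ι ⁻¹' A)

/-- A proper extension: moreover `E[∑_{v ∈ S_G} g[G, o, v]] = E[∑_{v ∈ S_G} g[G, v, o]]` for all
measurable `g : 𝒢_** → ℝ≥0`. -/
structure IsProperExtension {Ξ₀ : Type w} [MetricSpace Ξ₀] [MetricSpace Ξ] (ι : Ξ₀ → Ξ)
    (μ₀ : Measure (NetStar Ξ₀)) (μ : Measure (NetStar Ξ)) (S : CovariantSubset Ξ) : Prop
    extends IsExtension ι μ₀ μ S where
  mass_transport : ∀ g : NetStarStar Ξ → ℝ≥0, Measurable g →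
    ∫⁻ x, outSumOn S (fun z => (g z : ℝ≥0∞)) x ∂μ = ∫⁻ x, inSumOn S (fun z => (g z : ℝ≥0∞)) x ∂μ

/-- Almost surely, `T_G` is a Markovian kernel from `V(G)` to `S_G`: for all `v ∈ V(G)`,
`T⁺_G(v) = 1` and `T_G(v, ·)` vanishes outside `S_G`. -/
def IsMarkovianInto [MetricSpace Ξ] (T : NetStarStar Ξ → ℝ≥0) (μ : Measure (NetStar Ξ))
    (S : CovariantSubset Ξ) : Prop :=
  ∀ᵐ x ∂μ, ∀ (G : Network Ξ) (o : G.V), cls G ![o] = x → ∀ v : G.V,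
    outSum (fun z => (T z : ℝ≥0∞)) (cls G ![v]) = 1 ∧
    ∀ w : G.V, w ∉ S.verts G → T (cls G ![v, w]) = 0

/-! ### Unimodularizations -/

/-- The distribution of the non-rooted network `[G]` on `(𝒢, J)`, if `[G, o]` has law `μ`. -/
def unrootedLaw [MetricSpace Ξ] (μ : Measure (NetStar Ξ)) : Measure (NetClass Ξ) :=
  μ.map unroot

/-- `ν` is a strong unimodularization of the random non-rooted network with law `μ₀`. -/
structure IsStrongUnimodularization [MetricSpace Ξ] (ν : Measure (NetStar Ξ))
    (μ₀ : Measure (NetClass Ξ)) : Prop where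
  prob : IsProbabilityMeasure ν
  unimodular : Unimodular ν
  law_eq : unrootedLaw ν = μ₀

/-- `ν` is a weak unimodularization of the random non-rooted network with law `μ₀`. -/
structure IsWeakUnimodularization [MetricSpace Ξ] (ν : Measure (NetStar Ξ))
    (μ₀ : Measure (NetClass Ξ)) : Prop where
  prob : IsProbabilityMeasure ν
  unimodular : Unimodular ν
  abs_cont : unrootedLaw ν ≪ μ₀
  abs_cont' : μ₀ ≪ unrootedLaw ν

/-- The random non-rooted network with law `μ₀` can be unimodularized. -/
def CanBeUnimodularized [MetricSpace Ξ] (μ₀ : Measure (NetClass Ξ)) : Prop :=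
  ∃ ν : Measure (NetStar Ξ), IsWeakUnimodularization ν μ₀ ∨ IsStrongUnimodularization ν μ₀

/-- `M [G, o] = T⁻_G(o)`, a `[0, ∞]`-valued function. -/
def receivedMass (T : NetStarStar Ξ → ℝ≥0) : NetStar Ξ → ℝ≥0∞ :=
  inSum (fun z => (T z : ℝ≥0∞))

/-- `E[M | I]`, the conditional expectation of `M ≥ 0` on the invariant sigma-field. -/
def condReceivedMass [MetricSpace Ξ] (T : NetStarStar Ξ → ℝ≥0) (μ : Measure (NetStar Ξ)) :
    NetStar Ξ → ℝ≥0∞ :=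
  condLExp (invariantField Ξ) μ (receivedMass T)

/-- `∑_{v ∈ V(G)} T_G(v, o) 1_A [G, v]`. -/
def receivedFrom (T : NetStarStar Ξ → ℝ≥0) (A : Set (NetStar Ξ)) : NetStar Ξ → ℝ≥0∞ :=
  inSum ((proj₁ ⁻¹' A).indicator (fun z => (T z : ℝ≥0∞)))

/-- `P_T[A] = (1 / E[M]) E[∑_v T_G(v, o) 1_A[G, v]]`. -/
def weakFormula [MetricSpace Ξ] (T : NetStarStar Ξ → ℝ≥0) (μ : Measure (NetStar Ξ))
    (A : Set (NetStar Ξ)) : ℝ≥0∞ :=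
  (∫⁻ x, receivedMass T x ∂μ)⁻¹ * ∫⁻ x, receivedFrom T A x ∂μ

/-- `P'_T[A] = E[(1 / E[M | I]) ∑_v T_G(v, o) 1_A[G, v]]`. -/
def strongFormula [MetricSpace Ξ] (T : NetStarStar Ξ → ℝ≥0) (μ : Measure (NetStar Ξ))
    (A : Set (NetStar Ξ)) : ℝ≥0∞ :=
  ∫⁻ x, (condReceivedMass T μ x)⁻¹ * receivedFrom T A x ∂μ

theorem invariantField_le (Ξ : Type u) [MetricSpace Ξ] :
    invariantField Ξ ≤ (inferInstance : MeasurableSpace (NetStar Ξ)) :=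
  fun _ hA => hA.1

theorem measurable_unroot [MetricSpace Ξ] : Measurable (unroot (Ξ := Ξ)) :=
  fun _ hB => hB

end RandomNetwork

end

/-! Let `E` be the event that the root lies in `S_G`. The extension enters through two facts only:
the root is a.s. in `E`, and mass transport holds when one end of the transport is the root and the
other is confined to `E` (`MassTransportOn`).

Existence. Move the root from `o` to `v` with weight `f(o) T(v, o)`, where `f` is `I`-measurable;
this is `massLaw f T μ`. It is unimodular: apply the restricted principle to the transport `f(o)
∑_{v,w} T(v, o) g(v, w) T(w, u)`. Since each `T(w, ·)` is a probability on `S_G`, the sum over the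
far end disappears on either side, leaving the weighted sums of `g⁺` and of `g⁻`
(`MassTransportOn.massLaw`). On an invariant event `B` the new measure has mass `E[f M 1_B]`, so `f
= 1 / E[M | I]` reproduces the law of `[G]` and `f = 1 / E[M]` gives an equivalent law. Dividing is
harmless because `P(B) ≤ E[M 1_B]`: the vertices of `S_G` alone already send that much
(`MassTransportOn.le_setLIntegral_inSum`).

Necessity and uniqueness. A finite measure carried by `E` that satisfies the restricted principle is
determined by its values on `I` (`MassTransportOn.eq_of_eq_on_invariantField`); with `E` everything,
this is the uniqueness of the strong unimodularization. If `ν` is any unimodularization, its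
restriction to `E` satisfies the same principle as `μ`, hence equals `k μ` with `k` an
`I`-measurable density. Under `ν` all the mass is received in `E`, so `E[k M] = 1`, that is `E[k E[M
| I]] = 1`; as `k > 0` a.s., `E[M | I]` is a.s. finite (`condLExp_inSum_lt_top`).

Measurability of sums over vertices rests on the kernel `vertexKernel`, which is lower
semicontinuous on open sets. -/

theorem MeasureTheory.lintegral_mul_condLExp {Ω : Type*} {m m₀ : MeasurableSpace Ω} (hm : m ≤ m₀)
    (P : Measure[m₀] Ω) [SigmaFinite (P.trim hm)] {f X : Ω → ℝ≥0∞} (hf : Measurable[m] f)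
    (hX : Measurable[m₀] X) :
    ∫⁻ x, f x * condLExp m P X x ∂P = ∫⁻ x, f x * X x ∂P := by
  have hf' : Measurable[m₀] f := hf.mono hm le_rfl
  have hC : Measurable[m₀] (condLExp m P X) := measurable_condLExp' m P X
  -- The measures with densities `X` and its conditional expectation agree on `m`, and both sides
  -- integrate the `m`-measurable `f` against them. No integrability is needed.
  have h1 : (P.withDensity (condLExp m P X)).trim hm = (P.withDensity X).trim hm := by
    refine @Measure.ext _ m _ _ fun s hs => ?_
    rw [trim_measurableSet_eq hm hs, trim_measurableSet_eq hm hs, withDensity_apply _ (hm s hs),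
      withDensity_apply _ (hm s hs), setLIntegral_condLExp hm P X hs]
  have h2 : ∀ Y : Ω → ℝ≥0∞, Measurable[m₀] Y →
      ∫⁻ x, f x * Y x ∂P = ∫⁻ x, f x ∂((P.withDensity Y).trim hm) := by
    intro Y hY
    rw [lintegral_trim hm hf, lintegral_withDensity_eq_lintegral_mul _ hY hf']
    simp only [Pi.mul_apply, mul_comm]
  rw [h2 _ hC, h2 _ hX, h1]

theorem SimpleGraph.Connected.exists_adj_of_dist_le_succ {V : Type*} {G : SimpleGraph V}
    (hG : G.Connected) {a b : V} {r : ℕ} (h : G.dist a b ≤ r + 1) :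
    G.dist a b ≤ r ∨ ∃ c, G.dist a c ≤ r ∧ G.Adj c b := by
  rcases Nat.lt_or_ge (G.dist a b) (r + 1) with h' | h'
  · exact Or.inl (by omega)
  right
  obtain ⟨p, hp⟩ := hG.exists_walk_length_eq_dist b a
  rw [SimpleGraph.dist_comm] at hp
  cases p with
  | nil => simp at h'
  | cons hadj q =>
    refine ⟨_, ?_, hadj.symm⟩
    have := SimpleGraph.dist_le q
    rw [SimpleGraph.dist_comm] at this
    simp only [SimpleGraph.Walk.length_cons] at hp
    omega

noncomputable section

namespace RandomNetwork

universe u w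

/-! ### Isomorphisms between induced subgraphs -/

namespace MarkedGraph

variable {Ξ : Type u}

/-- The inclusion of the vertices of an induced subgraph. -/
def vertexVal (G : MarkedGraph Ξ) (s : Set G.V) : (G.induce s).V → G.V := Subtype.val

/-- The inclusion of the edges of an induced subgraph. -/
def edgeVal (G : MarkedGraph Ξ) (s : Set G.V) : (G.induce s).E → G.E := Subtype.val

theorem vertexVal_injective (G : MarkedGraph Ξ) (s : Set G.V) :
    Function.Injective (G.vertexVal s) := Subtype.val_injective

theorem induce_ends_map_val (G : MarkedGraph Ξ) (s : Set G.V) (e : (G.induce s).E) :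
    ((G.induce s).ends e).map (G.vertexVal s) = G.ends e.1 :=
  Sym2.attachWith_map_subtypeVal _

theorem mem_induce_ends {G : MarkedGraph Ξ} {s : Set G.V} {e : (G.induce s).E}
    {v : (G.induce s).V} : v ∈ (G.induce s).ends e ↔ v.1 ∈ G.ends e.1 := by
  refine ⟨mem_ends_of_mem_attachWith _ _, fun h => ?_⟩
  rw [← induce_ends_map_val, Sym2.mem_map] at h
  obtain ⟨a, ha, hav⟩ := h
  rwa [← Subtype.ext hav]

/-- The inclusion between induced subgraphs, on the vertices. -/
def inclV {G : MarkedGraph Ξ} {s s' : Set G.V} (hs : s' ⊆ s) (v : (G.induce s').V) :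
    (G.induce s).V := ⟨v.1, hs v.2⟩

/-- The inclusion between induced subgraphs, on the edges. -/
def inclE {G : MarkedGraph Ξ} {s s' : Set G.V} (hs : s' ⊆ s) (e : (G.induce s').E) :
    (G.induce s).E := ⟨e.1, fun v hv => hs (e.2 v hv)⟩

theorem ends_inclE {G : MarkedGraph Ξ} {s s' : Set G.V} (hs : s' ⊆ s) (e : (G.induce s').E) :
    (G.induce s).ends (inclE hs e) = ((G.induce s').ends e).map (inclV hs) := by
  apply Sym2.map.injective (vertexVal_injective _ _)
  rw [induce_ends_map_val, Sym2.map_map]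
  exact (induce_ends_map_val G s' e).symm

namespace GraphEquiv

theorem ends_edge_val {G H : MarkedGraph Ξ} {s : Set G.V} {t : Set H.V}
    (φ : GraphEquiv (G.induce s) (H.induce t)) (e : (G.induce s).E) :
    H.ends (φ.edge e).1 = ((G.induce s).ends e).map (fun v => H.vertexVal t (φ.vertex v)) := by
  rw [← induce_ends_map_val, φ.ends_edge, Sym2.map_map]; rfl

theorem mem_ends_edge_val {G H : MarkedGraph Ξ} {s : Set G.V} {t : Set H.V}
    (φ : GraphEquiv (G.induce s) (H.induce t)) {e : (G.induce s).E} {w : H.V} :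
    w ∈ H.ends (φ.edge e).1 ↔ ∃ v : (G.induce s).V, v.1 ∈ G.ends e.1 ∧ (φ.vertex v).1 = w := by
  rw [ends_edge_val, Sym2.mem_map]
  exact ⟨fun ⟨v, hv, h⟩ => ⟨v, mem_induce_ends.1 hv, h⟩,
    fun ⟨v, hv, h⟩ => ⟨v, mem_induce_ends.2 hv, h⟩⟩

theorem restrict_symm_aux {G H : MarkedGraph Ξ} {s s' : Set G.V} {t t' : Set H.V}
    {φ : GraphEquiv (G.induce s) (H.induce t)}
    (h : ∀ v, H.vertexVal t (φ.vertex v) ∈ t' ↔ G.vertexVal s v ∈ s') (w : (H.induce t).V) :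
    G.vertexVal s (φ.symm.vertex w) ∈ s' ↔ H.vertexVal t w ∈ t' := by
  rw [← h]
  have : φ.vertex (φ.symm.vertex w) = w := φ.vertex.apply_symm_apply w
  rw [this]

/-- The restriction of an isomorphism between induced subgraphs, on the vertices. -/
def restrictVertex {G H : MarkedGraph Ξ} {s s' : Set G.V} {t t' : Set H.V}
    (φ : GraphEquiv (G.induce s) (H.induce t)) (hs : s' ⊆ s)
    (h : ∀ v, H.vertexVal t (φ.vertex v) ∈ t' ↔ G.vertexVal s v ∈ s') (v : (G.induce s').V) :
    (H.induce t').V :=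
  ⟨H.vertexVal t (φ.vertex (inclV hs v)), (h _).2 v.2⟩

/-- The restriction of an isomorphism between induced subgraphs, on the edges. -/
def restrictEdge {G H : MarkedGraph Ξ} {s s' : Set G.V} {t t' : Set H.V}
    (φ : GraphEquiv (G.induce s) (H.induce t)) (hs : s' ⊆ s)
    (h : ∀ v, H.vertexVal t (φ.vertex v) ∈ t' ↔ G.vertexVal s v ∈ s') (e : (G.induce s').E) :
    (H.induce t').E :=
  ⟨(φ.edge (inclE hs e)).1, fun w hw => by
    obtain ⟨v, hv, rfl⟩ := φ.mem_ends_edge_val.1 hw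
    exact (h v).2 (e.2 _ hv)⟩

/-- Restriction of an isomorphism between induced subgraphs to corresponding sets of vertices. -/
def restrict {G H : MarkedGraph Ξ} {s s' : Set G.V} {t t' : Set H.V}
    (φ : GraphEquiv (G.induce s) (H.induce t)) (hs : s' ⊆ s) (ht : t' ⊆ t)
    (h : ∀ v, H.vertexVal t (φ.vertex v) ∈ t' ↔ G.vertexVal s v ∈ s') :
    GraphEquiv (G.induce s') (H.induce t') where
  vertex :=
    { toFun := φ.restrictVertex hs h
      invFun := φ.symm.restrictVertex ht (restrict_symm_aux h)
      left_inv := fun v => Subtype.ext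
        (congrArg (G.vertexVal s) (φ.vertex.symm_apply_apply (inclV hs v)))
      right_inv := fun w => Subtype.ext
        (congrArg (H.vertexVal t) (φ.vertex.apply_symm_apply (inclV ht w))) }
  edge :=
    { toFun := φ.restrictEdge hs h
      invFun := φ.symm.restrictEdge ht (restrict_symm_aux h)
      left_inv := fun e => Subtype.ext
        (congrArg (G.edgeVal s) (φ.edge.symm_apply_apply (inclE hs e)))
      right_inv := fun e => Subtype.ext
        (congrArg (H.edgeVal t) (φ.edge.apply_symm_apply (inclE ht e))) }
  ends_edge e := by
    apply Sym2.map.injective (vertexVal_injective _ _)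
    rw [induce_ends_map_val]
    refine (φ.ends_edge_val (inclE hs e)).trans ?_
    rw [ends_inclE, Sym2.map_map, Sym2.map_map]
    rfl

theorem MarksWithin.restrict [MetricSpace Ξ] {G H : MarkedGraph Ξ} {s s' : Set G.V}
    {t t' : Set H.V} {φ : GraphEquiv (G.induce s) (H.induce t)} {ε : ℝ} (hφ : φ.MarksWithin ε)
    (hs : s' ⊆ s) (ht : t' ⊆ t)
    (h : ∀ v, H.vertexVal t (φ.vertex v) ∈ t' ↔ G.vertexVal s v ∈ s') :
    (φ.restrict hs ht h).MarksWithin ε := by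
  refine ⟨fun v => hφ.1 (inclV hs v), fun v e he he' => ?_⟩
  have h1 : inclV hs v ∈ (G.induce s).ends (inclE hs e) := by
    rw [ends_inclE, Sym2.mem_map]; exact ⟨v, he, rfl⟩
  exact hφ.2 _ _ h1 (φ.vertex_mem h1)

/-- An isomorphism, seen as one between the subgraphs induced on all the vertices. -/
def induceUniv {G H : MarkedGraph Ξ} (φ : GraphEquiv G H) :
    GraphEquiv (G.induce univ) (H.induce univ) where
  vertex :=
    { toFun := fun v => ⟨φ.vertex v.1, mem_univ _⟩
      invFun := fun v => ⟨φ.vertex.symm v.1, mem_univ _⟩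
      left_inv := fun v => Subtype.ext (φ.vertex.symm_apply_apply _)
      right_inv := fun v => Subtype.ext (φ.vertex.apply_symm_apply _) }
  edge :=
    { toFun := fun v => ⟨φ.edge v.1, fun _ _ => mem_univ _⟩
      invFun := fun v => ⟨φ.edge.symm v.1, fun _ _ => mem_univ _⟩
      left_inv := fun v => Subtype.ext (φ.edge.symm_apply_apply _)
      right_inv := fun v => Subtype.ext (φ.edge.apply_symm_apply _) }
  ends_edge e := by
    apply Sym2.map.injective (vertexVal_injective _ _)
    rw [induce_ends_map_val, Sym2.map_map]
    refine (φ.ends_edge e.1).trans ?_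
    rw [← G.induce_ends_map_val univ e, Sym2.map_map]; rfl

theorem PreservesMarks.marksWithin_induceUniv [MetricSpace Ξ] {G H : MarkedGraph Ξ}
    {φ : GraphEquiv G H} (hφ : φ.PreservesMarks) {ε : ℝ} (hε : 0 < ε) :
    φ.induceUniv.MarksWithin ε := by
  refine ⟨fun v => ?_, fun v e h h' => ?_⟩
  · have : (H.induce univ).vmark (φ.induceUniv.vertex v) = (G.induce univ).vmark v := hφ.1 v.1
    rwa [this, dist_self]
  · have : (H.induce univ).emark (φ.induceUniv.vertex v) (φ.induceUniv.edge e) h' =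
        (G.induce univ).emark v e h := hφ.2 v.1 e.1 (mem_induce_ends.1 h) (mem_induce_ends.1 h')
    rwa [this, dist_self]

theorem adj_vertex {G H : MarkedGraph Ξ} (φ : GraphEquiv G H) {a b : G.V}
    (h : G.simple.Adj a b) : H.simple.Adj (φ.vertex a) (φ.vertex b) := by
  obtain ⟨hne, e, he⟩ := h
  exact ⟨φ.vertex.injective.ne hne, φ.edge e, by rw [φ.ends_edge, he, Sym2.map_mk]⟩

end GraphEquiv

theorem induce_adj {G : MarkedGraph Ξ} {s : Set G.V} {a b : (G.induce s).V} :
    (G.induce s).simple.Adj a b ↔ G.simple.Adj a.1 b.1 := by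
  constructor
  · rintro ⟨hne, e, he⟩
    refine ⟨Subtype.val_injective.ne hne, e.1, ?_⟩
    rw [← induce_ends_map_val, he, Sym2.map_mk]; rfl
  · rintro ⟨hne, e, he⟩
    refine ⟨fun h => hne (congrArg Subtype.val h), ⟨e, fun v hv => ?_⟩, ?_⟩
    · rw [he, Sym2.mem_iff] at hv
      rcases hv with rfl | rfl
      · exact a.2
      · exact b.2
    · apply Sym2.map.injective (vertexVal_injective _ _)
      exact (induce_ends_map_val G s _).trans he

end MarkedGraph

theorem dist_le_succ_of_adj {Ξ : Type u} (G : Network Ξ) {a b c : G.V} {r : ℕ}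
    (h : G.simple.dist a b ≤ r) (hbc : G.simple.Adj b c) : G.simple.dist a c ≤ r + 1 := by
  have h1 := G.connected.dist_triangle (u := a) (v := b) (w := c)
  have h2 := SimpleGraph.dist_eq_one_iff_adj.2 hbc
  omega

/-! ### The local topology: neighbourhood bases and continuity -/

section Local

variable {Ξ : Type u}

open MarkedGraph

/-- Geodesics from `a` of length at most `r` stay in `s`, so `φ` carries them edge by edge to walks
in `H`. Nothing is required of `t`; the reverse inequality comes from `φ.symm`. -/
theorem dist_equiv_le {G H : Network Ξ} {s : Set G.V} {t : Set H.V}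
    (φ : GraphEquiv (G.toMarkedGraph.induce s) (H.toMarkedGraph.induce t)) (a : s) (r : ℕ)
    (hs : ∀ v, G.simple.dist a.1 v ≤ r → v ∈ s) (v : s) (hv : G.simple.dist a.1 v.1 ≤ r) :
    H.simple.dist (φ.vertex a).1 (φ.vertex v).1 ≤ r := by
  induction r generalizing v with
  | zero =>
    have : a = v := Subtype.ext ((G.connected.dist_eq_zero_iff).1 (by omega))
    subst this
    exact le_of_eq SimpleGraph.dist_self
  | succ r ih =>
    rcases G.connected.exists_adj_of_dist_le_succ hv with h | ⟨c, hc, hadj⟩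
    · exact (ih (fun v hv => hs v (by omega)) v h).trans (by omega)
    · have hcs : c ∈ s := hs c (by omega)
      refine dist_le_succ_of_adj H (ih (fun v hv => hs v (by omega)) ⟨c, hcs⟩ hc) ?_
      exact induce_adj.1 (φ.adj_vertex (a := ⟨c, hcs⟩) (b := v) (induce_adj.2 hadj))

theorem dist_equiv_le_iff {G H : Network Ξ} {s : Set G.V} {t : Set H.V}
    (φ : GraphEquiv (G.toMarkedGraph.induce s) (H.toMarkedGraph.induce t)) (a : s) (r : ℕ)
    (hs : ∀ v, G.simple.dist a.1 v ≤ r → v ∈ s)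
    (ht : ∀ v, H.simple.dist (φ.vertex a).1 v ≤ r → v ∈ t) (v : s) :
    H.simple.dist (φ.vertex a).1 (φ.vertex v).1 ≤ r ↔ G.simple.dist a.1 v.1 ≤ r := by
  refine ⟨fun h => ?_, dist_equiv_le φ a r hs v⟩
  have := dist_equiv_le φ.symm (φ.vertex a) r ht (φ.vertex v) h
  have h1 : ∀ x : s, φ.symm.vertex (φ.vertex x) = x := φ.vertex.symm_apply_apply
  rwa [h1, h1] at this

theorem finite_closedBall (G : Network Ξ) (a : G.V) (r : ℕ) :
    {v | G.simple.dist a v ≤ r}.Finite := by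
  induction r with
  | zero =>
    refine (finite_singleton a).subset fun v hv => ?_
    exact ((G.connected.dist_eq_zero_iff).1 (Nat.le_zero.1 hv)).symm
  | succ r ih =>
    have : ∀ c : G.V, {b | G.simple.Adj c b}.Finite := by
      intro c
      have h1 : (⋃ e ∈ {e | c ∈ G.ends e}, {b | b ∈ G.ends e}).Finite := by
        refine (G.locallyFinite c).biUnion fun e _ => ?_
        induction G.ends e with
        | _ x y => exact (Set.toFinite {x, y}).subset fun b hb => by simpa using hb
      refine h1.subset ?_
      rintro b ⟨-, e, he⟩
      simp only [mem_iUnion]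
      exact ⟨e, by simp [he], by simp [he]⟩
    refine (ih.union (ih.biUnion fun c _ => this c)).subset fun v hv => ?_
    rcases G.connected.exists_adj_of_dist_le_succ hv with h | ⟨c, hc, hadj⟩
    · exact Or.inl h
    · exact Or.inr (mem_biUnion hc hadj)

theorem finite_ball {n : ℕ} (X : RootedNetwork Ξ n) (r : ℕ) : (ball X r).Finite := by
  have : ball X r = ⋃ i, {v | X.net.simple.dist (X.root i) v ≤ r} := by ext; simp [ball]
  rw [this]
  exact finite_iUnion fun i => finite_closedBall _ _ _

theorem finite_induce_edges (G : MarkedGraph Ξ) {s : Set G.V} (hs : s.Finite) :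
    Finite (G.induce s).E := by
  have : {e : G.E | ∀ v ∈ G.ends e, v ∈ s}.Finite := by
    refine (hs.biUnion fun v _ => G.locallyFinite v).subset fun e he => ?_
    have hx : (Quot.out (G.ends e)).1 ∈ G.ends e := Sym2.out_fst_mem _
    exact mem_biUnion (he _ hx) hx
  exact this.to_subtype

theorem RootedClass.exists_rep {n : ℕ} (x : RootedClass Ξ n) :
    ∃ X : RootedNetwork Ξ n, cls X.net X.root = x := Quotient.exists_rep x

variable [MetricSpace Ξ]

/-- An isomorphism between larger vertex sets that matches the roots also matches distances up to
`r`, so it restricts to the balls. This gives the stability of local closeness under isomorphism,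
smaller radii and loss of roots. -/
theorem LocallyClose.of_equiv {n r : ℕ} {ε : ℝ} {X Y : RootedNetwork Ξ n} {s : Set X.net.V}
    {t : Set Y.net.V}
    (φ : GraphEquiv (X.net.toMarkedGraph.induce s) (Y.net.toMarkedGraph.induce t))
    (hφ : φ.MarksWithin ε) (hs : ball X r ⊆ s) (ht : ball Y r ⊆ t)
    (hroot : ∀ i, (φ.vertex ⟨X.root i, hs (root_mem_ball X r i)⟩).1 = Y.root i) :
    LocallyClose X Y r ε := by
  have key : ∀ v : (X.net.toMarkedGraph.induce s).V, (φ.vertex v).1 ∈ ball Y r ↔ v.1 ∈ ball X r := by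
    intro v
    refine exists_congr fun i => ?_
    rw [← hroot i]
    refine dist_equiv_le_iff φ ⟨X.root i, _⟩ r (fun v hv => hs ⟨i, hv⟩) (fun v hv => ht ⟨i, ?_⟩) v
    rwa [hroot i] at hv
  exact ⟨φ.restrict hs ht key, hφ.restrict hs ht key, fun i => Subtype.ext (hroot i)⟩

theorem LocallyClose.of_iso {n r : ℕ} {ε : ℝ} (hε : 0 < ε) {X Y : RootedNetwork Ξ n}
    (h : cls X.net X.root = cls Y.net Y.root) : LocallyClose X Y r ε := by
  obtain ⟨φ, hφ, hr⟩ := Quotient.exact h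
  exact LocallyClose.of_equiv φ.induceUniv (hφ.marksWithin_induceUniv hε) (subset_univ _)
    (subset_univ _) hr

theorem LocallyClose.select {n m r : ℕ} {ε : ℝ} {X Y : RootedNetwork Ξ n}
    (h : LocallyClose X Y r ε) (f : Fin m → Fin n) :
    LocallyClose ⟨X.net, fun j => X.root (f j)⟩ ⟨Y.net, fun j => Y.root (f j)⟩ r ε := by
  obtain ⟨φ, hφ, hr⟩ := h
  exact LocallyClose.of_equiv φ hφ (fun v ⟨i, hi⟩ => ⟨f i, hi⟩) (fun v ⟨i, hi⟩ => ⟨f i, hi⟩)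
    fun i => congrArg Subtype.val (hr (f i))

theorem LocallyClose.mono {n r r' : ℕ} {ε ε' : ℝ} {X Y : RootedNetwork Ξ n}
    (h : LocallyClose X Y r ε) (hr : r' ≤ r) (hε : ε ≤ ε') : LocallyClose X Y r' ε' := by
  obtain ⟨φ, hφ, h⟩ := h
  exact LocallyClose.of_equiv φ
    ⟨fun v => (hφ.1 v).trans_le hε, fun v e he he' => (hφ.2 v e he he').trans_le hε⟩
    (fun v ⟨i, hi⟩ => ⟨i, hi.trans hr⟩) (fun v ⟨i, hi⟩ => ⟨i, hi.trans hr⟩)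
    fun i => congrArg Subtype.val (h i)

theorem LocallyClose.trans {n r : ℕ} {ε ε' : ℝ} {X Y Z : RootedNetwork Ξ n}
    {φ : GraphEquiv (X.net.toMarkedGraph.induce (ball X r)) (Y.net.toMarkedGraph.induce (ball Y r))}
    (hφ : φ.MarksWithin ε)
    (hφr : ∀ i, φ.vertex ⟨X.root i, root_mem_ball X r i⟩ = ⟨Y.root i, root_mem_ball Y r i⟩)
    (h : LocallyClose Y Z r ε') : LocallyClose X Z r (ε + ε') := by
  obtain ⟨ψ, hψ, hψr⟩ := h
  refine ⟨φ.trans ψ, ⟨fun v => ?_, fun v e he he' => ?_⟩, fun i => ?_⟩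
  · rw [add_comm]
    exact (dist_triangle _ _ _).trans_lt (add_lt_add (hψ.1 (φ.vertex v)) (hφ.1 v))
  · rw [add_comm]
    exact (dist_triangle _ _ _).trans_lt
      (add_lt_add (hψ.2 _ _ (φ.vertex_mem he) he') (hφ.2 v e he (φ.vertex_mem he)))
  · exact (congrArg ψ.vertex (hφr i)).trans (hψr i)

/-- Strict bounds on finitely many marks leave some room. -/
theorem MarksWithin.exists_lt {G H : MarkedGraph Ξ} {ε : ℝ} [Finite G.V] [Finite G.E]
    {φ : GraphEquiv G H} (hφ : φ.MarksWithin ε) : ∃ δ < ε, φ.MarksWithin δ := by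
  have h1 : ∀ᶠ δ in nhdsWithin ε (Iio ε), ∀ v : G.V, dist (H.vmark (φ.vertex v)) (G.vmark v) < δ := by
    rw [Filter.eventually_all]
    exact fun v => Filter.Eventually.filter_mono nhdsWithin_le_nhds (lt_mem_nhds (hφ.1 v))
  have h2 : ∀ᶠ δ in nhdsWithin ε (Iio ε), ∀ (v : G.V) (e : G.E) (h : v ∈ G.ends e),
      dist (H.emark (φ.vertex v) (φ.edge e) (φ.vertex_mem h)) (G.emark v e h) < δ := by
    simp only [Filter.eventually_all]
    exact fun v e h => Filter.Eventually.filter_mono nhdsWithin_le_nhds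
      (lt_mem_nhds (hφ.2 v e h _))
  obtain ⟨δ, ⟨ha, hb⟩, hc⟩ := ((h1.and h2).and self_mem_nhdsWithin).exists
  exact ⟨δ, hc, ha, fun v e h _ => hb v e h⟩

/-- `LocallyClose X` is open at each of its members. -/
theorem LocallyClose.exists_forall {n r : ℕ} {ε : ℝ} {X Y : RootedNetwork Ξ n}
    (h : LocallyClose X Y r ε) :
    ∃ δ > 0, ∀ Z, LocallyClose Y Z r δ → LocallyClose X Z r ε := by
  obtain ⟨φ, hφ, hr⟩ := h
  have := (finite_ball X r).to_subtype
  have : Finite (X.net.toMarkedGraph.induce (ball X r)).V := this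
  have := finite_induce_edges X.net.toMarkedGraph (finite_ball X r)
  obtain ⟨δ, hδ, hφ'⟩ := MarksWithin.exists_lt hφ
  refine ⟨ε - δ, by linarith, fun Z hZ => ?_⟩
  have := LocallyClose.trans hφ' hr hZ
  rwa [add_sub_cancel] at this

theorem isOpen_localNhd {n : ℕ} (X : RootedNetwork Ξ n) (r : ℕ) {ε : ℝ} (hε : 0 < ε) :
    IsOpen {y : RootedClass Ξ n | ∃ Y : RootedNetwork Ξ n, cls Y.net Y.root = y ∧
      LocallyClose X Y r ε} :=
  TopologicalSpace.isOpen_generateFrom_of_mem ⟨X, r, ε, hε, rfl⟩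

/-- The local neighbourhoods are only declared to be a subbase. As each is open at every member,
they form a neighbourhood base; finite intersections cost the larger radius and the smaller
precision. -/
theorem exists_locallyClose_subset {n : ℕ} {U : Set (RootedClass Ξ n)} (hU : IsOpen U)
    (X : RootedNetwork Ξ n) (hX : cls X.net X.root ∈ U) :
    ∃ (r : ℕ) (ε : ℝ), 0 < ε ∧ ∀ Y, LocallyClose X Y r ε → cls Y.net Y.root ∈ U := by
  induction hU with
  | basic s hs =>
    obtain ⟨X', r, ε, hε, rfl⟩ := hs
    obtain ⟨X'', hX'', hl⟩ := hX
    obtain ⟨δ, hδ, h⟩ := hl.exists_forall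
    -- The generating set may contain the class of `X` through another representative `X''`, so
    -- closeness to `X` is first turned into closeness to `X''`.
    obtain ⟨δ', hδ', h'⟩ := (LocallyClose.of_iso (r := r) hδ hX'').exists_forall
    exact ⟨r, δ', hδ', fun Y hY => ⟨Y, rfl, h Y (h' Y hY)⟩⟩
  | univ => exact ⟨0, 1, one_pos, fun _ _ => mem_univ _⟩
  | inter s t _ _ hs ht =>
    obtain ⟨r, ε, hε, h⟩ := hs hX.1
    obtain ⟨r', ε', hε', h'⟩ := ht hX.2
    exact ⟨max r r', min ε ε', lt_min hε hε', fun Y hY =>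
      ⟨h Y (hY.mono (le_max_left _ _) (min_le_left _ _)),
        h' Y (hY.mono (le_max_right _ _) (min_le_right _ _))⟩⟩
  | sUnion 𝒮 _ ih =>
    obtain ⟨s, hs, hXs⟩ := hX
    obtain ⟨r, ε, hε, h⟩ := ih s hs hXs
    exact ⟨r, ε, hε, fun Y hY => ⟨s, hs, h Y hY⟩⟩

/-- A set is open when it contains, with a class, all the classes that look locally alike. -/
theorem isOpen_of_forall_locallyClose {n : ℕ} {U : Set (RootedClass Ξ n)}
    (h : ∀ X : RootedNetwork Ξ n, cls X.net X.root ∈ U →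
      ∃ (r : ℕ) (ε : ℝ), 0 < ε ∧ ∀ Y, LocallyClose X Y r ε → cls Y.net Y.root ∈ U) :
    IsOpen U := by
  rw [isOpen_iff_forall_mem_open]
  intro x hx
  obtain ⟨X, rfl⟩ := x.exists_rep
  obtain ⟨r, ε, hε, h⟩ := h X hx
  refine ⟨_, ?_, isOpen_localNhd X r hε, X, rfl, LocallyClose.of_iso hε rfl⟩
  rintro _ ⟨Y, rfl, hY⟩
  exact h Y hY

theorem continuous_select {n m : ℕ} (f : Fin m → Fin n) :
    Continuous (select f : RootedClass Ξ n → RootedClass Ξ m) := by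
  refine continuous_def.2 fun U hU => isOpen_of_forall_locallyClose fun X hX => ?_
  obtain ⟨r, ε, hε, h⟩ := exists_locallyClose_subset hU ⟨X.net, fun j => X.root (f j)⟩ hX
  exact ⟨r, ε, hε, fun Y hY => h _ (hY.select f)⟩

/-- The classes in which the roots `i` and `j` are at distance at most `k`. -/
def rootsWithin {n : ℕ} (i j : Fin n) (k : ℕ) : Set (RootedClass Ξ n) :=
  {x | ∃ X : RootedNetwork Ξ n, cls X.net X.root = x ∧
    X.net.simple.dist (X.root i) (X.root j) ≤ k}

theorem LocallyClose.dist_le_iff {n r k : ℕ} {ε : ℝ} {X Y : RootedNetwork Ξ n}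
    (h : LocallyClose X Y r ε) (hk : k ≤ r) (i j : Fin n) :
    Y.net.simple.dist (Y.root i) (Y.root j) ≤ k ↔
      X.net.simple.dist (X.root i) (X.root j) ≤ k := by
  obtain ⟨φ, hφ, hr⟩ := h
  have hi := congrArg Subtype.val (hr i)
  have hj := congrArg Subtype.val (hr j)
  have := dist_equiv_le_iff φ ⟨X.root i, root_mem_ball X r i⟩ k
    (fun v hv => ⟨i, hv.trans hk⟩) (fun v hv => ⟨i, by rw [hi] at hv; exact hv.trans hk⟩)
    ⟨X.root j, root_mem_ball X r j⟩
  rwa [hi, hj] at this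

theorem cls_mem_rootsWithin {n : ℕ} {i j : Fin n} {k : ℕ} (G : Network Ξ) (o : Fin n → G.V) :
    cls G o ∈ rootsWithin (Ξ := Ξ) i j k ↔ G.simple.dist (o i) (o j) ≤ k := by
  refine ⟨?_, fun h => ⟨⟨G, o⟩, rfl, h⟩⟩
  rintro ⟨X, hX, h⟩
  exact ((LocallyClose.of_iso (Y := ⟨G, o⟩) (r := k) one_pos hX).dist_le_iff le_rfl i j).2 h

theorem isOpen_rootsWithin {n : ℕ} (i j : Fin n) (k : ℕ) :
    IsOpen (rootsWithin (Ξ := Ξ) i j k) := by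
  refine isOpen_of_forall_locallyClose fun X hX => ⟨k, 1, one_pos, fun Y hY => ?_⟩
  rw [cls_mem_rootsWithin] at hX ⊢
  exact (hY.dist_le_iff le_rfl i j).2 hX

end Local

/-! ### Sums over vertices as a measurable kernel -/

section VertexKernel

variable {Ξ : Type u}

open MarkedGraph

theorem monotone_rootsWithin {n : ℕ} (i j : Fin n) : Monotone (rootsWithin (Ξ := Ξ) i j) :=
  fun _ _ hkl _ ⟨X, hX, h⟩ => ⟨X, hX, h.trans hkl⟩

theorem exists_cls_one (x : NetStar Ξ) : ∃ (G : Network Ξ) (o : G.V), cls G ![o] = x := by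
  obtain ⟨X, rfl⟩ := x.exists_rep
  exact ⟨X.net, X.root 0, congrArg (cls X.net) (by ext i; fin_cases i; rfl)⟩

theorem exists_cls_two (x : NetStarStar Ξ) :
    ∃ (G : Network Ξ) (o v : G.V), cls G ![o, v] = x := by
  obtain ⟨X, rfl⟩ := x.exists_rep
  exact ⟨X.net, X.root 0, X.root 1, congrArg (cls X.net) (by ext i; fin_cases i <;> rfl)⟩

theorem proj₁_cls (G : Network Ξ) (o v : G.V) : proj₁ (cls G ![o, v]) = cls G ![o] :=
  congrArg (cls G) (by ext i; fin_cases i; rfl)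

theorem proj₂_cls (G : Network Ξ) (o v : G.V) : proj₂ (cls G ![o, v]) = cls G ![v] :=
  congrArg (cls G) (by ext i; fin_cases i; rfl)

/-- `[G, o, v] ↦ [G, v, o]`. -/
def swapRoots : NetStarStar Ξ → NetStarStar Ξ := select ![1, 0]

theorem swapRoots_cls (G : Network Ξ) (o v : G.V) : swapRoots (cls G ![o, v]) = cls G ![v, o] :=
  congrArg (cls G) (by ext i; fin_cases i <;> rfl)

theorem inSum_cls (g : NetStarStar Ξ → ℝ≥0∞) (G : Network Ξ) (o : G.V) :
    inSum g (cls G ![o]) = ∑' v, g (cls G ![v, o]) := rfl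

theorem outSum_cls (g : NetStarStar Ξ → ℝ≥0∞) (G : Network Ξ) (o : G.V) :
    outSum g (cls G ![o]) = ∑' v, g (cls G ![o, v]) := rfl

theorem outSum_eq_inSum_comp_swapRoots (g : NetStarStar Ξ → ℝ≥0∞) :
    outSum g = inSum (g ∘ swapRoots) := by
  funext x
  obtain ⟨G, o, rfl⟩ := exists_cls_one x
  simp only [inSum_cls, outSum_cls, Function.comp, swapRoots_cls]

variable [MetricSpace Ξ]

/-- A vertex `v` of the ball can be promoted to a root. Its `k`-ball still lies in the old `r`-ball,
so the old isomorphism serves for the enlarged tuple of roots. -/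
theorem LocallyClose.exists_vertex_map {n r : ℕ} {ε : ℝ} {X Y : RootedNetwork Ξ (n + 1)}
    (h : LocallyClose X Y r ε) : ∃ f : ball X r → Y.net.V, Function.Injective f ∧
      ∀ (v : ball X r) (k : ℕ), X.net.simple.dist (X.root 0) v + k ≤ r →
        LocallyClose (n := n + 2) ⟨X.net, Matrix.vecCons v.1 X.root⟩
          ⟨Y.net, Matrix.vecCons (f v) Y.root⟩ k ε := by
  obtain ⟨φ, hφ, hr⟩ := h
  refine ⟨fun v => (φ.vertex v).1, Subtype.val_injective.comp φ.vertex.injective, fun v k hk => ?_⟩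
  have h0 := congrArg Subtype.val (hr 0)
  -- The image of `v` is no farther from the root than `v` is, so its `k`-ball also fits in the
  -- `r`-ball of `Y`.
  have hd := dist_equiv_le φ ⟨X.root 0, root_mem_ball X r 0⟩ _
    (fun u hu => ⟨0, hu.trans (by omega : X.net.simple.dist (X.root 0) v ≤ r)⟩) v le_rfl
  rw [h0] at hd
  refine LocallyClose.of_equiv (X := ⟨X.net, Matrix.vecCons v.1 X.root⟩)
    (Y := ⟨Y.net, Matrix.vecCons (φ.vertex v).1 Y.root⟩) φ hφ ?_ ?_ ?_
  · rintro u ⟨i, hi⟩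
    induction i using Fin.cases with
    | zero =>
      have := X.net.connected.dist_triangle (u := X.root 0) (v := v.1) (w := u)
      have hi : X.net.simple.dist v.1 u ≤ k := hi
      exact ⟨0, by omega⟩
    | succ i => exact ⟨i, le_trans hi (by omega)⟩
  · rintro u ⟨i, hi⟩
    induction i using Fin.cases with
    | zero =>
      have := Y.net.connected.dist_triangle (u := Y.root 0) (v := (φ.vertex v).1) (w := u)
      have hi : Y.net.simple.dist (φ.vertex v).1 u ≤ k := hi
      exact ⟨0, by dsimp only at hd; omega⟩
    | succ i => exact ⟨i, le_trans hi (by omega)⟩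
  · intro i
    induction i using Fin.cases with
    | zero => rfl
    | succ i => exact congrArg Subtype.val (hr i)

/-- The measure `∑_v δ_[G, v, o]` on `𝒢_{n+1}`, for `[G, o]` in `𝒢_n`. -/
def vertexKernel {n : ℕ} : RootedClass Ξ n → Measure (RootedClass Ξ (n + 1)) :=
  Quotient.lift (fun X : RootedNetwork Ξ n =>
    Measure.sum fun v : X.net.V => Measure.dirac (cls X.net (Matrix.vecCons v X.root))) (by
    rintro X Y ⟨φ, hφ, hr⟩
    refine Measure.ext fun s hs => ?_
    simp only [Measure.sum_apply _ hs]
    rw [← φ.vertex.tsum_eq]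
    refine tsum_congr fun v => ?_
    rw [cls_eq_of_equiv hφ (Matrix.vecCons v X.root) (Matrix.vecCons (φ.vertex v) Y.root) fun i => ?_]
    induction i using Fin.cases with
    | zero => rfl
    | succ i => exact hr i)

theorem vertexKernel_apply {n : ℕ} (G : Network Ξ) (o : Fin n → G.V)
    {A : Set (RootedClass Ξ (n + 1))} (hA : MeasurableSet A) :
    vertexKernel (cls G o) A = ∑' v : G.V, A.indicator 1 (cls G (Matrix.vecCons v o)) := by
  refine (Measure.sum_apply _ hA).trans (tsum_congr fun v => ?_)
  exact Measure.dirac_apply' _ hA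

theorem lintegral_vertexKernel {n : ℕ} (G : Network Ξ) (o : Fin n → G.V)
    {g : RootedClass Ξ (n + 1) → ℝ≥0∞} (hg : Measurable g) :
    ∫⁻ z, g z ∂(vertexKernel (cls G o)) = ∑' v : G.V, g (cls G (Matrix.vecCons v o)) := by
  refine (lintegral_sum_measure _ _).trans (tsum_congr fun v => ?_)
  exact lintegral_dirac' _ hg

/-- If finitely many vertices `v` have `[G, v, o] ∈ U`, a close enough network contains distinct
copies of all of them, still in `U` because `U` is open. Hence the count can only increase nearby.
-/
theorem lowerSemicontinuous_vertexKernel {n : ℕ} {U : Set (RootedClass Ξ (n + 2))}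
    (hU : IsOpen U) :
    LowerSemicontinuous fun x : RootedClass Ξ (n + 1) => vertexKernel x U := by
  refine lowerSemicontinuous_iff_isOpen_preimage.2 fun a => ?_
  refine isOpen_of_forall_locallyClose fun X hX => ?_
  simp only [mem_preimage, mem_Ioi] at hX ⊢
  rw [vertexKernel_apply _ _ hU.measurableSet, ENNReal.tsum_eq_iSup_sum, lt_iSup_iff] at hX
  obtain ⟨s, hs⟩ := hX
  let I := {v : X.net.V // v ∈ s ∧ cls X.net (Matrix.vecCons v X.root) ∈ U}
  have : Finite I := Finite.of_injective (fun v : I => (⟨v.1, v.2.1⟩ : s))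
    fun v w h => Subtype.ext (congrArg (fun x : s => x.1) h)
  have hI : ∀ v : I, ∃ (r : ℕ) (ε : {ε : ℝ // 0 < ε}), ∀ Y : RootedNetwork Ξ (n + 2),
      LocallyClose ⟨X.net, Matrix.vecCons v.1 X.root⟩ Y r ε → cls Y.net Y.root ∈ U := by
    intro v
    obtain ⟨r, ε, hε, h⟩ := exists_locallyClose_subset hU ⟨X.net, Matrix.vecCons v.1 X.root⟩ v.2.2
    exact ⟨r, ⟨ε, hε⟩, h⟩
  choose r ε h using hI
  -- One radius around the root that contains the neighbourhoods needed by all the counted vertices.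
  obtain ⟨R, hR⟩ := Finite.exists_le fun v : I => X.net.simple.dist (X.root 0) v + r v
  obtain ⟨δ, hδ⟩ := Finite.exists_ge ε
  refine ⟨R, δ, δ.2, fun Y hY => ?_⟩
  obtain ⟨f, hf, hfY⟩ := hY.exists_vertex_map
  rw [vertexKernel_apply _ _ hU.measurableSet]
  refine hs.trans_le ?_
  have hRI : ∀ v : I, v.1 ∈ ball X R := fun v => ⟨0, by have := hR v; omega⟩
  let j : I → Y.net.V := fun v => f ⟨v.1, hRI v⟩
  have hj : Function.Injective j := fun v w h => Subtype.ext (congrArg (fun x : ball X R => x.1) (hf h))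
  have hjU : ∀ v : I, cls Y.net (Matrix.vecCons (j v) Y.root) ∈ U := fun v =>
    h v ⟨Y.net, Matrix.vecCons (j v) Y.root⟩ ((hfY ⟨v.1, hRI v⟩ (r v) (hR v)).mono le_rfl (hδ v))
  calc ∑ v ∈ s, U.indicator 1 (cls X.net (Matrix.vecCons v X.root))
      = ∑ v ∈ s, {v | v ∈ s ∧ cls X.net (Matrix.vecCons v X.root) ∈ U}.indicator
          (1 : X.net.V → ℝ≥0∞) v := by
        refine Finset.sum_congr rfl fun v hv => ?_
        by_cases h : cls X.net (Matrix.vecCons v X.root) ∈ U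
        · rw [indicator_of_mem h]
          exact (indicator_of_mem (s := {v | v ∈ s ∧ cls X.net (Matrix.vecCons v X.root) ∈ U})
            ⟨hv, h⟩ 1).symm
        · rw [indicator_of_notMem h, indicator_of_notMem fun h' => h h'.2]
    _ ≤ ∑' v, {v | v ∈ s ∧ cls X.net (Matrix.vecCons v X.root) ∈ U}.indicator
          (1 : X.net.V → ℝ≥0∞) v := ENNReal.sum_le_tsum s
    _ = ∑' v : I, 1 := (tsum_subtype _ _).symm
    _ = ∑' v : I, U.indicator 1 (cls Y.net (Matrix.vecCons (j v) Y.root)) :=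
        tsum_congr fun v => (indicator_of_mem (hjU v) 1).symm
    _ ≤ ∑' w, U.indicator 1 (cls Y.net (Matrix.vecCons w Y.root)) :=
        ENNReal.tsum_comp_le_tsum_of_injective hj
          (fun w => U.indicator 1 (cls Y.net (Matrix.vecCons w Y.root)))

theorem vertexKernel_rootsWithin_lt_top {n : ℕ} (x : RootedClass Ξ (n + 1)) (k : ℕ) :
    vertexKernel x (rootsWithin 1 0 k) < ⊤ := by
  obtain ⟨X, rfl⟩ := x.exists_rep
  rw [vertexKernel_apply _ _ (isOpen_rootsWithin 1 0 k).measurableSet]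
  have hfin := finite_closedBall X.net (X.root 0) k
  rw [tsum_eq_sum (s := hfin.toFinset)]
  · refine ENNReal.sum_lt_top.2 fun v _ => ?_
    exact lt_of_le_of_lt (indicator_le_self' (fun _ _ => zero_le) _) ENNReal.one_lt_top
  · intro v hv
    refine indicator_of_notMem (fun h => hv ?_) _
    rw [cls_mem_rootsWithin] at h
    rw [Finite.mem_toFinset]
    exact h

theorem iUnion_rootsWithin {n : ℕ} (i j : Fin n) :
    ⋃ k, rootsWithin (Ξ := Ξ) i j k = univ := by
  refine eq_univ_of_forall fun x => ?_
  obtain ⟨X, rfl⟩ := x.exists_rep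
  exact mem_iUnion.2 ⟨_, (cls_mem_rootsWithin _ _).2 le_rfl⟩

/-- Open sets form a π-system, but the π-λ argument needs finite measures. It is run on each
restriction to pairs of roots at distance at most `k`, finite by local finiteness, and then `k`
increases. -/
theorem measurable_vertexKernel {n : ℕ} :
    Measurable (vertexKernel : RootedClass Ξ (n + 1) → Measure (RootedClass Ξ (n + 2))) := by
  have hB : ∀ k, MeasurableSet (rootsWithin (Ξ := Ξ) (1 : Fin (n + 2)) 0 k) :=
    fun k => (isOpen_rootsWithin 1 0 k).measurableSet
  have key : ∀ k : ℕ, Measurable fun x : RootedClass Ξ (n + 1) =>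
      (vertexKernel x).restrict (rootsWithin 1 0 k) := by
    intro k
    have : ∀ x : RootedClass Ξ (n + 1),
        IsFiniteMeasure ((vertexKernel x).restrict (rootsWithin 1 0 k)) :=
      fun x => ⟨by rw [Measure.restrict_apply_univ]; exact vertexKernel_rootsWithin_lt_top x k⟩
    have hopen : ∀ U : Set (RootedClass Ξ (n + 2)), IsOpen U → Measurable
        fun x : RootedClass Ξ (n + 1) => (vertexKernel x).restrict (rootsWithin 1 0 k) U := by
      intro U hU
      simp_rw [Measure.restrict_apply hU.measurableSet]
      exact (lowerSemicontinuous_vertexKernel (hU.inter (isOpen_rootsWithin 1 0 k))).measurable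
    exact Measurable.measure_of_isPiSystem (S := {U | IsOpen U}) rfl isPiSystem_isOpen hopen
      (hopen _ isOpen_univ)
  refine Measure.measurable_of_measurable_coe _ fun A hA => ?_
  have h : ∀ x : RootedClass Ξ (n + 1), vertexKernel x A =
      ⨆ k, (vertexKernel x).restrict (rootsWithin 1 0 k) A := by
    intro x
    simp_rw [Measure.restrict_apply hA]
    rw [← Monotone.measure_iUnion, ← inter_iUnion, iUnion_rootsWithin, inter_univ]
    exact fun k l hkl => inter_subset_inter_right _ (monotone_rootsWithin 1 0 hkl)
  simp_rw [h]
  exact Measurable.iSup fun k => (Measure.measurable_coe hA).comp (key k)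

/-! ### Sums over vertices -/

theorem measurable_proj₁ : Measurable (proj₁ (Ξ := Ξ)) := (continuous_select _).measurable

theorem measurable_proj₂ : Measurable (proj₂ (Ξ := Ξ)) := (continuous_select _).measurable

theorem measurable_swapRoots : Measurable (swapRoots (Ξ := Ξ)) := (continuous_select _).measurable

theorem measurable_inSum {g : NetStarStar Ξ → ℝ≥0∞} (hg : Measurable g) :
    Measurable (inSum g) := by
  have : inSum g = fun x => ∫⁻ z, g z ∂(vertexKernel x) := by
    funext x
    obtain ⟨G, o, rfl⟩ := exists_cls_one x
    rw [lintegral_vertexKernel _ _ hg]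
    rfl
  rw [this]
  exact (Measure.measurable_lintegral hg).comp measurable_vertexKernel

theorem measurable_outSum {g : NetStarStar Ξ → ℝ≥0∞} (hg : Measurable g) :
    Measurable (outSum g) := by
  rw [outSum_eq_inSum_comp_swapRoots]
  exact measurable_inSum (hg.comp measurable_swapRoots)

/-- The composition `[G, o, u] ↦ ∑_w a [G, o, w] b [G, w, u]` of two transports. -/
def transportComp (a b : NetStarStar Ξ → ℝ≥0∞) (z : NetStarStar Ξ) : ℝ≥0∞ :=
  ∫⁻ y, a (select ![1, 0] y) * b (select ![0, 2] y) ∂(vertexKernel z)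

theorem transportComp_cls {a b : NetStarStar Ξ → ℝ≥0∞} (ha : Measurable a) (hb : Measurable b)
    (G : Network Ξ) (o u : G.V) :
    transportComp a b (cls G ![o, u]) = ∑' w, a (cls G ![o, w]) * b (cls G ![w, u]) := by
  refine (lintegral_vertexKernel _ _ ((ha.comp (continuous_select _).measurable).mul
    (hb.comp (continuous_select _).measurable))).trans (tsum_congr fun w => ?_)
  refine congrArg₂ (fun x y => a x * b y) (congrArg (cls G) ?_) (congrArg (cls G) ?_) <;>
  · ext i; fin_cases i <;> rfl

theorem measurable_transportComp {a b : NetStarStar Ξ → ℝ≥0∞} (ha : Measurable a)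
    (hb : Measurable b) : Measurable (transportComp a b) :=
  (Measure.measurable_lintegral ((ha.comp (continuous_select _).measurable).mul
    (hb.comp (continuous_select _).measurable))).comp measurable_vertexKernel

/-- A positive transport with total outgoing mass at most one. -/
theorem exists_pos_outSum_le_one : ∃ c : NetStarStar Ξ → ℝ≥0∞, Measurable c ∧ (∀ z, c z ≠ 0) ∧
    ∀ x, outSum c x ≤ 1 := by
  let N : ℕ → NetStar Ξ → ℝ≥0∞ := fun k => outSum ((rootsWithin 1 0 k).indicator 1)
  have hi : ∀ k, Measurable ((rootsWithin (Ξ := Ξ) (1 : Fin 2) 0 k).indicator (1 : NetStarStar Ξ → ℝ≥0∞)) :=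
    fun k => measurable_one.indicator (isOpen_rootsWithin 1 0 k).measurableSet
  have hN : ∀ k, Measurable (N k) := fun k => measurable_outSum (hi k)
  have hNtop : ∀ k x, N k x ≠ ⊤ := by
    intro k x
    obtain ⟨G, o, rfl⟩ := exists_cls_one x
    have := vertexKernel_rootsWithin_lt_top (cls G ![o]) k
    rw [vertexKernel_apply _ _ (isOpen_rootsWithin 1 0 k).measurableSet] at this
    refine ne_of_lt (lt_of_le_of_lt (le_of_eq (tsum_congr fun v => ?_)) this)
    simp only [indicator, cls_mem_rootsWithin]
    rw [SimpleGraph.dist_comm]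
    rfl
  -- A mixture over `k`, with weights `2^{-(k+1)}`, of uniform transports to the `k`-ball around the
  -- root, of cardinality `N k`.
  let c : NetStarStar Ξ → ℝ≥0∞ := fun z => ∑' k : ℕ,
    (2⁻¹ : ℝ≥0∞) ^ (k + 1) * ((N k (proj₁ z))⁻¹ * (rootsWithin 1 0 k).indicator 1 z)
  refine ⟨c, ?_, fun z => ?_, fun x => ?_⟩
  · refine Measurable.tsum fun k => Measurable.const_mul ?_ _
    exact ((hN k).comp measurable_proj₁).inv.mul (hi k)
  · obtain ⟨k, hk⟩ := mem_iUnion.1 ((iUnion_rootsWithin (Ξ := Ξ) (1 : Fin 2) 0).symm ▸ mem_univ z)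
    intro h0
    have := ENNReal.tsum_eq_zero.1 h0 k
    rw [indicator_of_mem hk] at this
    simp only [Pi.one_apply, mul_one, mul_eq_zero, pow_eq_zero_iff', ENNReal.inv_eq_zero,
      ENNReal.ofNat_ne_top, false_and, false_or] at this
    exact hNtop _ _ this
  · obtain ⟨G, o, rfl⟩ := exists_cls_one x
    rw [outSum_cls]
    simp only [c, proj₁_cls]
    rw [ENNReal.tsum_comm]
    simp_rw [ENNReal.tsum_mul_left]
    calc ∑' k : ℕ, (2⁻¹ : ℝ≥0∞) ^ (k + 1) * ((N k (cls G ![o]))⁻¹ * N k (cls G ![o]))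
        ≤ ∑' k : ℕ, (2⁻¹ : ℝ≥0∞) ^ (k + 1) * 1 := by
          gcongr with k
          exact ENNReal.inv_mul_le_one _
      _ = 1 := by
          simp only [mul_one]
          rw [ENNReal.tsum_geometric_add_one, ENNReal.one_sub_inv_two, inv_inv]
          exact ENNReal.inv_mul_cancel two_ne_zero ENNReal.ofNat_ne_top

end VertexKernel

/-! ### Invariant events and the restricted mass transport principle -/

section MassTransport

variable {Ξ : Type u}

theorem indicator_preimage_proj₁_cls (E : Set (NetStar Ξ)) (g : NetStarStar Ξ → ℝ≥0∞)
    (G : Network Ξ) (o v : G.V) : (proj₁ ⁻¹' E).indicator g (cls G ![o, v]) =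
      E.indicator 1 (cls G ![o]) * g (cls G ![o, v]) := by
  by_cases h : cls G ![o] ∈ E
  · rw [indicator_of_mem h, indicator_of_mem (by rwa [mem_preimage, proj₁_cls]), Pi.one_apply,
      one_mul]
  · rw [indicator_of_notMem h, indicator_of_notMem (by rwa [mem_preimage, proj₁_cls]), zero_mul]

theorem indicator_preimage_proj₂_cls (E : Set (NetStar Ξ)) (g : NetStarStar Ξ → ℝ≥0∞)
    (G : Network Ξ) (o v : G.V) : (proj₂ ⁻¹' E).indicator g (cls G ![o, v]) =
      E.indicator 1 (cls G ![v]) * g (cls G ![o, v]) := by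
  by_cases h : cls G ![v] ∈ E
  · rw [indicator_of_mem h, indicator_of_mem (by rwa [mem_preimage, proj₂_cls]), Pi.one_apply,
      one_mul]
  · rw [indicator_of_notMem h, indicator_of_notMem (by rwa [mem_preimage, proj₂_cls]), zero_mul]

theorem outSum_tsum (f : ℕ → NetStarStar Ξ → ℝ≥0∞) (x : NetStar Ξ) :
    outSum (fun z => ∑' n, f n z) x = ∑' n, outSum (f n) x := by
  obtain ⟨G, o, rfl⟩ := exists_cls_one x
  exact ENNReal.tsum_comm

theorem inSum_tsum (f : ℕ → NetStarStar Ξ → ℝ≥0∞) (x : NetStar Ξ) :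
    inSum (fun z => ∑' n, f n z) x = ∑' n, inSum (f n) x := by
  obtain ⟨G, o, rfl⟩ := exists_cls_one x
  exact ENNReal.tsum_comm

theorem outSum_mul_proj₁ (f : NetStar Ξ → ℝ≥0∞) (g : NetStarStar Ξ → ℝ≥0∞) (x : NetStar Ξ) :
    outSum (fun z => f (proj₁ z) * g z) x = f x * outSum g x := by
  obtain ⟨G, o, rfl⟩ := exists_cls_one x
  simp only [outSum_cls, proj₁_cls, ENNReal.tsum_mul_left]

theorem inSum_mul_proj₂ (f : NetStar Ξ → ℝ≥0∞) (g : NetStarStar Ξ → ℝ≥0∞) (x : NetStar Ξ) :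
    inSum (fun z => f (proj₂ z) * g z) x = f x * inSum g x := by
  obtain ⟨G, o, rfl⟩ := exists_cls_one x
  simp only [inSum_cls, proj₂_cls, ENNReal.tsum_mul_left]

/-- A function on `𝒢_*` that does not depend on the root. -/
def RootInvariant (f : NetStar Ξ → ℝ≥0∞) : Prop :=
  ∀ (G : Network Ξ) (o v : G.V), f (cls G ![o]) = f (cls G ![v])

theorem RootInvariant.comp_proj {f : NetStar Ξ → ℝ≥0∞} (hf : RootInvariant f)
    (z : NetStarStar Ξ) : f (proj₁ z) = f (proj₂ z) := by
  obtain ⟨G, o, v, rfl⟩ := exists_cls_two z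
  rw [proj₁_cls, proj₂_cls, hf]

/-- The event that all the vertices `v` are such that `[G, v] ∈ A`. -/
def everywhere (A : Set (NetStar Ξ)) : Set (NetStar Ξ) :=
  {x | outSum ((proj₂ ⁻¹' Aᶜ).indicator 1) x = 0}

theorem cls_mem_everywhere {A : Set (NetStar Ξ)} {G : Network Ξ} {o : G.V} :
    cls G ![o] ∈ everywhere A ↔ ∀ v : G.V, cls G ![v] ∈ A := by
  simp only [everywhere, mem_ofPred_eq, outSum_cls, ENNReal.tsum_eq_zero,
    indicator_preimage_proj₂_cls, Pi.one_apply, mul_one]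
  refine forall_congr' fun v => ?_
  by_cases h : cls G ![v] ∈ A <;> simp [h]

variable [MetricSpace Ξ]

/-- A condition on all vertices is the vanishing of a sum over vertices: this gives measurability
although the vertex set varies, and invariance is immediate. -/
theorem measurableSet_everywhere {A : Set (NetStar Ξ)} (hA : MeasurableSet A) :
    MeasurableSet[invariantField Ξ] (everywhere A) := by
  refine ⟨?_, fun G o v h => ?_⟩
  · exact measurable_outSum (measurable_one.indicator (measurable_proj₂ hA.compl))
      (measurableSet_singleton 0)
  · rw [cls_mem_everywhere] at h ⊢
    exact h

/-- The level set of `f` through `[G, o]` is an invariant event, so it contains every `[G, v]`. -/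
theorem rootInvariant_of_measurable {f : NetStar Ξ → ℝ≥0∞}
    (hf : Measurable[invariantField Ξ] f) : RootInvariant f := fun G o v =>
  ((hf (measurableSet_singleton (f (cls G ![o])))).2 G o v rfl).symm

theorem rootInvariant_indicator {B : Set (NetStar Ξ)} (hB : MeasurableSet[invariantField Ξ] B) :
    RootInvariant (B.indicator 1) := by
  refine rootInvariant_of_measurable ?_
  exact (@measurable_one _ _ _ (invariantField Ξ) _).indicator hB

/-- With the converse `measurableSet_preimage_unroot`, this identifies `I` with the pullback of `J`,
so laws on `𝒢` can be compared through their values on `I`. -/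
theorem exists_measurableSet_preimage_unroot {B : Set (NetStar Ξ)}
    (hB : MeasurableSet[invariantField Ξ] B) :
    ∃ C : Set (NetClass Ξ), MeasurableSet C ∧ unroot ⁻¹' C = B := by
  have h : unroot ⁻¹' (unroot '' B) = B := by
    refine Subset.antisymm ?_ (subset_preimage_image _ _)
    rintro x ⟨y, hy, hyx⟩
    obtain ⟨G, o, rfl⟩ := exists_cls_one x
    obtain ⟨H, p, rfl⟩ := exists_cls_one y
    obtain ⟨φ, hφ⟩ := Quotient.exact (s := networkSetoid Ξ) hyx
    rw [cls_eq_of_equiv hφ ![p] ![φ.vertex p] (by intro i; fin_cases i; rfl)] at hy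
    exact hB.2 G _ _ hy
  exact ⟨unroot '' B, show MeasurableSet (unroot ⁻¹' (unroot '' B)) by rw [h]; exact hB.1, h⟩

theorem measurableSet_preimage_unroot {C : Set (NetClass Ξ)} (hC : MeasurableSet C) :
    MeasurableSet[invariantField Ξ] (unroot ⁻¹' C) :=
  ⟨measurable_unroot hC, fun _ _ _ h => h⟩

/-- The mass transport principle for the roots in `E`, for `[0, ∞]`-valued transports. -/
def MassTransportOn (E : Set (NetStar Ξ)) (ν : Measure (NetStar Ξ)) : Prop :=
  ∀ g : NetStarStar Ξ → ℝ≥0∞, Measurable g →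
    ∫⁻ x, outSum ((proj₂ ⁻¹' E).indicator g) x ∂ν = ∫⁻ x, inSum ((proj₁ ⁻¹' E).indicator g) x ∂ν

/-- A `[0, ∞]`-valued transport is a countable sum of finite-valued ones, and both sides are
countably additive. -/
theorem MassTransportOn.of_nnreal {E : Set (NetStar Ξ)} (hE : MeasurableSet E)
    {ν : Measure (NetStar Ξ)} (h : ∀ g : NetStarStar Ξ → ℝ≥0, Measurable g →
      ∫⁻ x, outSum ((proj₂ ⁻¹' E).indicator fun z => (g z : ℝ≥0∞)) x ∂ν =
        ∫⁻ x, inSum ((proj₁ ⁻¹' E).indicator fun z => (g z : ℝ≥0∞)) x ∂ν) :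
    MassTransportOn E ν := by
  intro g hg
  have hind : ∀ A : Set (NetStarStar Ξ), A.indicator g =
      fun z => ∑' n, A.indicator (fun z => (SimpleFunc.eapproxDiff g n z : ℝ≥0∞)) z := by
    intro A
    funext z
    by_cases hz : z ∈ A
    · simp only [indicator_of_mem hz, SimpleFunc.tsum_eapproxDiff g hg]
    · simp only [indicator_of_notMem hz, tsum_zero]
  rw [hind, hind]
  simp_rw [outSum_tsum, inSum_tsum]
  have hm : ∀ n, Measurable fun z => (SimpleFunc.eapproxDiff g n z : ℝ≥0∞) := fun n =>
    (SimpleFunc.measurable _).coe_nnreal_ennreal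
  rw [lintegral_tsum fun n =>
      (measurable_outSum ((hm n).indicator (measurable_proj₂ hE))).aemeasurable,
    lintegral_tsum fun n =>
      (measurable_inSum ((hm n).indicator (measurable_proj₁ hE))).aemeasurable]
  exact tsum_congr fun n => h _ (SimpleFunc.measurable _)

theorem massTransportOn_univ_iff {ν : Measure (NetStar Ξ)} :
    MassTransportOn univ ν ↔ Unimodular ν := by
  refine ⟨fun h g hg => ?_, fun h => MassTransportOn.of_nnreal MeasurableSet.univ fun g hg => ?_⟩
  · simpa using h _ hg.coe_nnreal_ennreal
  · simpa using h g hg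

/-- Apply the full principle to the transport cut down to pairs with both ends in `E`: one
constraint becomes the restriction of `ν`, the other the indicator. -/
theorem MassTransportOn.restrict {E : Set (NetStar Ξ)} (hE : MeasurableSet E)
    {ν : Measure (NetStar Ξ)} (h : MassTransportOn univ ν) :
    MassTransportOn E (ν.restrict E) := by
  intro g hg
  have h1 : ∀ x, E.indicator (outSum ((proj₂ ⁻¹' E).indicator g)) x =
      outSum ((proj₂ ⁻¹' univ).indicator ((proj₁ ⁻¹' E).indicator ((proj₂ ⁻¹' E).indicator g))) x := by
    intro x
    obtain ⟨G, o, rfl⟩ := exists_cls_one x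
    rw [outSum_cls]
    simp only [indicator_preimage_proj₁_cls, preimage_univ, indicator_univ, ENNReal.tsum_mul_left]
    by_cases hx : cls G ![o] ∈ E <;> simp [hx, outSum_cls]
  have h2 : ∀ x, E.indicator (inSum ((proj₁ ⁻¹' E).indicator g)) x =
      inSum ((proj₁ ⁻¹' univ).indicator ((proj₁ ⁻¹' E).indicator ((proj₂ ⁻¹' E).indicator g))) x := by
    intro x
    obtain ⟨G, o, rfl⟩ := exists_cls_one x
    rw [inSum_cls, indicator_indicator, inter_comm, ← indicator_indicator]
    simp only [preimage_univ, indicator_univ, indicator_preimage_proj₁_cls,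
      indicator_preimage_proj₂_cls]
    by_cases hx : cls G ![o] ∈ E <;> simp [hx, inSum_cls, indicator_preimage_proj₁_cls]
  rw [← lintegral_indicator hE, ← lintegral_indicator hE]
  simp_rw [h1, h2]
  exact h _ ((hg.indicator (measurable_proj₂ hE)).indicator (measurable_proj₁ hE))

theorem MassTransportOn.add {E : Set (NetStar Ξ)} {ν₁ ν₂ : Measure (NetStar Ξ)}
    (h₁ : MassTransportOn E ν₁) (h₂ : MassTransportOn E ν₂) : MassTransportOn E (ν₁ + ν₂) := by
  intro g hg
  rw [lintegral_add_measure, lintegral_add_measure, h₁ g hg, h₂ g hg]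

/-- An invariant density takes the same value at both ends of a transport, so it can be absorbed
into it. -/
theorem MassTransportOn.withDensity {E : Set (NetStar Ξ)} (hE : MeasurableSet E)
    {ν : Measure (NetStar Ξ)} (h : MassTransportOn E ν) {f : NetStar Ξ → ℝ≥0∞}
    (hf : Measurable[invariantField Ξ] f) : MassTransportOn E (ν.withDensity f) := by
  have hf' : Measurable f := hf.mono (invariantField_le Ξ) le_rfl
  intro g hg
  rw [lintegral_withDensity_eq_lintegral_mul _ hf'
      (measurable_outSum (hg.indicator (measurable_proj₂ hE))),
    lintegral_withDensity_eq_lintegral_mul _ hf'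
      (measurable_inSum (hg.indicator (measurable_proj₁ hE)))]
  have key : ∀ A : Set (NetStarStar Ξ), A.indicator (fun z => f (proj₁ z) * g z) =
      fun z => f (proj₁ z) * A.indicator g z := by
    intro A
    funext z
    by_cases hz : z ∈ A <;> simp [hz]
  have := h (fun z => f (proj₁ z) * g z) ((hf'.comp measurable_proj₁).mul hg)
  rw [key, key] at this
  simp_rw [outSum_mul_proj₁] at this
  simp_rw [(rootInvariant_of_measurable hf).comp_proj, inSum_mul_proj₂] at this
  exact this

end MassTransport

/-! ### Mass transport and the values on `I` determine the measure -/

section Uniqueness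

variable {Ξ : Type u} [MetricSpace Ξ]

/-- Send mass from the complement of `P = {k₂ < k₁}` to `P`. Senders weigh at most as much under
`ν₁` as under `ν₂`, receivers strictly more, yet sent and received masses agree for each measure.
Hence no mass moves: up to a null set `P` is invariant. There the measures agree, so `P` is null. -/
theorem measure_le_of_eq_on_invariantField {E : Set (NetStar Ξ)} (hE : MeasurableSet E)
    {ν₁ ν₂ : Measure (NetStar Ξ)} [IsFiniteMeasure ν₁] [IsFiniteMeasure ν₂]
    (h₁ : MassTransportOn E ν₁) (h₂ : MassTransportOn E ν₂)
    (hE₁ : ∀ᵐ x ∂ν₁, x ∈ E) (hE₂ : ∀ᵐ x ∂ν₂, x ∈ E)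
    (heq : ∀ B, MeasurableSet[invariantField Ξ] B → ν₁ B = ν₂ B) : ν₁ ≤ ν₂ := by
  obtain ⟨c, hc, hcpos, hcle⟩ := exists_pos_outSum_le_one (Ξ := Ξ)
  set σ := ν₁ + ν₂ with hσ
  have hac₁ : ν₁ ≪ σ := Measure.absolutelyContinuous_of_le (Measure.le_add_right le_rfl)
  have hac₂ : ν₂ ≪ σ := Measure.absolutelyContinuous_of_le (Measure.le_add_left le_rfl)
  set k₁ := ν₁.rnDeriv σ
  set k₂ := ν₂.rnDeriv σ
  have hk₁ : Measurable k₁ := Measure.measurable_rnDeriv _ _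
  have hk₂ : Measurable k₂ := Measure.measurable_rnDeriv _ _
  have hν₁ : σ.withDensity k₁ = ν₁ := Measure.withDensity_rnDeriv_eq _ _ hac₁
  have hν₂ : σ.withDensity k₂ = ν₂ := Measure.withDensity_rnDeriv_eq _ _ hac₂
  set P : Set (NetStar Ξ) := {x | k₂ x < k₁ x} with hPdef
  have hP : MeasurableSet P := measurableSet_lt hk₂ hk₁
  -- Positivity of `c` will let a vanishing transport exclude every pair; the bound on its outgoing
  -- mass keeps the integrals finite.
  set g : NetStarStar Ξ → ℝ≥0∞ := (proj₁ ⁻¹' Pᶜ).indicator ((proj₂ ⁻¹' P).indicator c)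
  have hg : Measurable g :=
    (hc.indicator (measurable_proj₂ hP)).indicator (measurable_proj₁ hP.compl)
  have hgc : ∀ z, g z ≤ c z := fun z =>
    (indicator_le_self' (fun _ _ => zero_le) z).trans
      (indicator_le_self' (fun _ _ => zero_le) z)
  set L := outSum ((proj₂ ⁻¹' E).indicator g) with hLdef
  set R := inSum ((proj₁ ⁻¹' E).indicator g) with hRdef
  have hL : Measurable L := measurable_outSum (hg.indicator (measurable_proj₂ hE))
  have hR : Measurable R := measurable_inSum (hg.indicator (measurable_proj₁ hE))
  have hLcls : ∀ (G : Network Ξ) (o : G.V), L (cls G ![o]) = ∑' v, E.indicator 1 (cls G ![v]) *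
      (Pᶜ.indicator 1 (cls G ![o]) * (P.indicator 1 (cls G ![v]) * c (cls G ![o, v]))) := by
    intro G o
    simp only [hLdef, outSum_cls, g, indicator_preimage_proj₁_cls, indicator_preimage_proj₂_cls]
  have hL1 : ∀ x, L x ≤ 1 := by
    intro x
    refine le_trans ?_ (hcle x)
    obtain ⟨G, o, rfl⟩ := exists_cls_one x
    exact ENNReal.tsum_le_tsum fun v =>
      (indicator_le_self' (fun _ _ => zero_le) _).trans (hgc _)
  have hLP : ∀ x ∈ P, L x = 0 := by
    intro x hx
    obtain ⟨G, o, rfl⟩ := exists_cls_one x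
    simp [hLcls, hx]
  have hRP : ∀ x ∉ P, R x = 0 := by
    intro x hx
    obtain ⟨G, o, rfl⟩ := exists_cls_one x
    simp [hRdef, inSum_cls, g, indicator_preimage_proj₁_cls, indicator_preimage_proj₂_cls, hx]
  have hdens : ∀ {k : NetStar Ξ → ℝ≥0∞} {ν : Measure (NetStar Ξ)}, Measurable k →
      σ.withDensity k = ν → ∀ {F : NetStar Ξ → ℝ≥0∞}, Measurable F →
      ∫⁻ x, F x ∂ν = ∫⁻ x, k x * F x ∂σ := by
    rintro k _ hk rfl F hF
    exact lintegral_withDensity_eq_lintegral_mul _ hk hF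
  have hLle : ∫⁻ x, L x ∂ν₁ ≤ ∫⁻ x, L x ∂ν₂ := by
    rw [hdens hk₁ hν₁ hL, hdens hk₂ hν₂ hL]
    refine lintegral_mono fun x => ?_
    by_cases hx : x ∈ P
    · simp [hLP x hx]
    · exact mul_le_mul_left (not_lt.1 hx) _
  have hRle : ∀ x, k₂ x * R x ≤ k₁ x * R x := by
    intro x
    by_cases hx : x ∈ P
    · exact mul_le_mul_left (le_of_lt hx) _
    · simp [hRP x hx]
  have hRtop : ∫⁻ x, k₁ x * R x ∂σ ≠ ⊤ := by
    rw [← hdens hk₁ hν₁ hR, ← h₁ g hg]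
    refine ne_top_of_le_ne_top (measure_ne_top ν₁ univ) ?_
    calc ∫⁻ x, L x ∂ν₁ ≤ ∫⁻ _, 1 ∂ν₁ := lintegral_mono hL1
      _ = ν₁ univ := by simp
  have hRge : ∫⁻ x, k₁ x * R x ∂σ ≤ ∫⁻ x, k₂ x * R x ∂σ := by
    rw [← hdens hk₁ hν₁ hR, ← hdens hk₂ hν₂ hR, ← h₁ g hg, ← h₂ g hg]
    exact hLle
  have hReq : (fun x => k₂ x * R x) =ᵐ[σ] fun x => k₁ x * R x :=
    ae_eq_of_ae_le_of_lintegral_le (Filter.Eventually.of_forall hRle)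
      (ne_top_of_le_ne_top hRtop (lintegral_mono hRle)) (hk₁.mul hR).aemeasurable hRge
  have hR0 : R =ᵐ[σ] 0 := by
    filter_upwards [hReq, ae_lt_top (hk₁.mul hR) hRtop] with x hx hx'
    by_contra hne
    have hxP : x ∈ P := by
      by_contra h; exact hne (hRP x h)
    -- Here `k₁ x > 0` and `k₁ x * R x` is finite, so cancelling `R x` is legitimate.
    have hRx : R x ≠ ⊤ := by
      intro h
      simp only [Pi.mul_apply, h] at hx'
      rw [ENNReal.mul_top (pos_of_gt (show k₂ x < k₁ x from hxP)).ne'] at hx'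
      exact lt_irrefl _ hx'
    exact (ENNReal.mul_lt_mul_left hne hRx hxP).ne hx
  have hL0 : L =ᵐ[σ] 0 := by
    rw [← lintegral_eq_zero_iff hL, (h₁.add h₂) g hg, lintegral_eq_zero_iff hR]
    exact hR0
  have hEσ : ∀ᵐ x ∂σ, x ∈ E := by
    rw [hσ, ae_add_measure_iff]; exact ⟨hE₁, hE₂⟩
  -- The invariant event that some vertex lies in `E ∩ P`. The vanishing of `L` forces the root to
  -- lie in `P` on it, almost everywhere.
  set Q : Set (NetStar Ξ) := (everywhere (E ∩ P)ᶜ)ᶜ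
  have hQ : MeasurableSet[invariantField Ξ] Q :=
    (measurableSet_everywhere (hE.inter hP).compl).compl
  have hPQ : P =ᵐ[σ] Q := by
    filter_upwards [hL0, hEσ] with x hx hxE
    obtain ⟨G, o, rfl⟩ := exists_cls_one x
    refine propext ⟨fun h => ?_, fun h => ?_⟩
    · intro h'
      exact cls_mem_everywhere.1 h' o ⟨hxE, h⟩
    · by_contra hxP
      have hxP : cls G ![o] ∉ P := hxP
      refine h (cls_mem_everywhere.2 fun v hv => ?_)
      rw [hLcls] at hx
      have := ENNReal.tsum_eq_zero.1 hx v
      rw [indicator_of_mem hv.1, indicator_of_mem hv.2, indicator_of_mem (show _ ∈ Pᶜ from hxP)]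
        at this
      simp only [Pi.one_apply, one_mul] at this
      exact hcpos _ this
  have hPeq : ν₁ P = ν₂ P := by
    rw [measure_congr (hac₁.ae_eq hPQ), measure_congr (hac₂.ae_eq hPQ), heq Q hQ]
  have hPnull : ∀ᵐ x ∂σ, x ∉ P := by
    have e₁ : ν₁ P = ∫⁻ x in P, k₁ x ∂σ := by rw [← hν₁, withDensity_apply _ hP]
    have e₂ : ν₂ P = ∫⁻ x in P, k₂ x ∂σ := by rw [← hν₂, withDensity_apply _ hP]
    have hle : k₂ ≤ᵐ[σ.restrict P] k₁ := by
      filter_upwards [ae_restrict_mem hP] with x hx using le_of_lt hx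
    have := ae_eq_of_ae_le_of_lintegral_le hle (by rw [← e₂]; exact measure_ne_top _ _)
      hk₁.aemeasurable (by rw [← e₁, ← e₂, hPeq])
    rw [Filter.EventuallyEq, ae_restrict_iff' hP] at this
    filter_upwards [this] with x hx hxP
    exact (show k₂ x < k₁ x from hxP).ne (hx hxP)
  rw [← hν₁, ← hν₂]
  refine withDensity_mono ?_
  filter_upwards [hPnull] with x hx using not_lt.1 hx

/-- A finite measure that satisfies the mass transport principle on `E`, and is carried by `E`, is
determined by its restriction to the invariant sigma-field. -/
theorem MassTransportOn.eq_of_eq_on_invariantField {E : Set (NetStar Ξ)} (hE : MeasurableSet E)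
    {ν₁ ν₂ : Measure (NetStar Ξ)} [IsFiniteMeasure ν₁] [IsFiniteMeasure ν₂]
    (h₁ : MassTransportOn E ν₁) (h₂ : MassTransportOn E ν₂)
    (hE₁ : ∀ᵐ x ∂ν₁, x ∈ E) (hE₂ : ∀ᵐ x ∂ν₂, x ∈ E)
    (heq : ∀ B, MeasurableSet[invariantField Ξ] B → ν₁ B = ν₂ B) : ν₁ = ν₂ :=
  le_antisymm (measure_le_of_eq_on_invariantField hE h₁ h₂ hE₁ hE₂ heq)
    (measure_le_of_eq_on_invariantField hE h₂ h₁ hE₂ hE₁ fun B hB => (heq B hB).symm)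

end Uniqueness

/-! ### Rerooting along the kernel -/

section MassLaw

variable {Ξ : Type u}

/-- The classes `[G, o]` in which the root sends a total mass `1`, all of it into `E`. -/
def markovSet (E : Set (NetStar Ξ)) (T : NetStarStar Ξ → ℝ≥0∞) : Set (NetStar Ξ) :=
  {x | outSum T x = 1 ∧ outSum ((proj₂ ⁻¹' Eᶜ).indicator T) x = 0}

theorem eq_zero_of_mem_markovSet {E : Set (NetStar Ξ)} {T : NetStarStar Ξ → ℝ≥0∞}
    {G : Network Ξ} {o v : G.V} (h : cls G ![o] ∈ markovSet E T) (hv : cls G ![v] ∉ E) :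
    T (cls G ![o, v]) = 0 := by
  have := ENNReal.tsum_eq_zero.1 h.2 v
  rw [indicator_preimage_proj₂_cls, indicator_of_mem (show _ ∈ Eᶜ from hv)] at this
  simpa using this

theorem tsum_of_mem_markovSet {E : Set (NetStar Ξ)} {T : NetStarStar Ξ → ℝ≥0∞}
    {G : Network Ξ} {o : G.V} (h : cls G ![o] ∈ markovSet E T) :
    ∑' v, E.indicator 1 (cls G ![v]) * T (cls G ![o, v]) = 1 := by
  refine Eq.trans (tsum_congr fun v => ?_) h.1
  by_cases hv : cls G ![v] ∈ E
  · simp [hv]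
  · simp [eq_zero_of_mem_markovSet h hv]

variable [MetricSpace Ξ]

theorem measurableSet_markovSet {E : Set (NetStar Ξ)} (hE : MeasurableSet E)
    {T : NetStarStar Ξ → ℝ≥0∞} (hT : Measurable T) : MeasurableSet (markovSet E T) :=
  (measurable_outSum hT (measurableSet_singleton 1)).inter
    (measurable_outSum (hT.indicator (measurable_proj₂ hE.compl)) (measurableSet_singleton 0))

/-- The measure `A ↦ E[f ∑_v T(v, o) 1_A[G, v]]`. -/
def massLaw (f : NetStar Ξ → ℝ≥0∞) (T : NetStarStar Ξ → ℝ≥0∞) (μ : Measure (NetStar Ξ)) :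
    Measure (NetStar Ξ) :=
  (((μ.withDensity f).bind vertexKernel).withDensity T).map proj₁

theorem lintegral_massLaw {f : NetStar Ξ → ℝ≥0∞} (hf : Measurable f)
    {T : NetStarStar Ξ → ℝ≥0∞} (hT : Measurable T) (μ : Measure (NetStar Ξ))
    {h : NetStar Ξ → ℝ≥0∞} (hh : Measurable h) :
    ∫⁻ x, h x ∂(massLaw f T μ) = ∫⁻ x, f x * inSum (fun z => T z * h (proj₁ z)) x ∂μ := by
  have hm : Measurable fun z => T z * h (proj₁ z) := hT.mul (hh.comp measurable_proj₁)
  rw [massLaw, lintegral_map hh measurable_proj₁,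
    lintegral_withDensity_eq_lintegral_mul (g := fun z => h (proj₁ z)) _ hT
      (hh.comp measurable_proj₁)]
  simp only [Pi.mul_apply]
  rw [Measure.lintegral_bind measurable_vertexKernel.aemeasurable hm.aemeasurable]
  refine (lintegral_withDensity_eq_lintegral_mul _ hf
    ((Measure.measurable_lintegral hm).comp measurable_vertexKernel)).trans ?_
  refine lintegral_congr fun x => ?_
  obtain ⟨G, o, rfl⟩ := exists_cls_one x
  exact congrArg (f (cls G ![o]) * ·) (lintegral_vertexKernel G ![o] hm)

theorem massLaw_apply {f : NetStar Ξ → ℝ≥0∞} (hf : Measurable f)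
    {T : NetStarStar Ξ → ℝ≥0∞} (hT : Measurable T) (μ : Measure (NetStar Ξ))
    {A : Set (NetStar Ξ)} (hA : MeasurableSet A) :
    massLaw f T μ A = ∫⁻ x, f x * inSum ((proj₁ ⁻¹' A).indicator T) x ∂μ := by
  rw [← lintegral_indicator_one hA, lintegral_massLaw hf hT μ (measurable_one.indicator hA)]
  refine lintegral_congr fun x => ?_
  congr 2
  funext z
  by_cases hz : proj₁ z ∈ A
  · simp [hz]
  · simp [hz]

theorem inSum_indicator_of_invariant {B : Set (NetStar Ξ)}
    (hB : MeasurableSet[invariantField Ξ] B) (T : NetStarStar Ξ → ℝ≥0∞) (x : NetStar Ξ) :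
    inSum ((proj₁ ⁻¹' B).indicator T) x = B.indicator (inSum T) x := by
  have : (proj₁ ⁻¹' B).indicator T = fun z => B.indicator 1 (proj₂ z) * T z := by
    funext z
    rw [← (rootInvariant_indicator hB).comp_proj]
    by_cases hz : proj₁ z ∈ B <;> simp [hz]
  rw [this, inSum_mul_proj₂]
  by_cases hx : x ∈ B <;> simp [hx]

theorem massLaw_apply_of_invariant {f : NetStar Ξ → ℝ≥0∞} (hf : Measurable f)
    {T : NetStarStar Ξ → ℝ≥0∞} (hT : Measurable T) (μ : Measure (NetStar Ξ))
    {B : Set (NetStar Ξ)} (hB : MeasurableSet[invariantField Ξ] B) :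
    massLaw f T μ B = ∫⁻ x, B.indicator f x * inSum T x ∂μ := by
  rw [massLaw_apply hf hT μ hB.1]
  refine lintegral_congr fun x => ?_
  rw [inSum_indicator_of_invariant hB]
  by_cases hx : x ∈ B <;> simp [hx]

theorem MassTransportOn.massLaw {E : Set (NetStar Ξ)} {μ : Measure (NetStar Ξ)}
    (hμ : MassTransportOn E μ) {T : NetStarStar Ξ → ℝ≥0∞} (hT : Measurable T)
    (hM : ∀ᵐ x ∂μ, x ∈ everywhere (markovSet E T)) {f : NetStar Ξ → ℝ≥0∞}
    (hf : Measurable[invariantField Ξ] f) : MassTransportOn univ (massLaw f T μ) := by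
  have hf' : Measurable f := hf.mono (invariantField_le Ξ) le_rfl
  intro g hg
  simp only [preimage_univ, indicator_univ]
  rw [lintegral_massLaw hf' hT μ (measurable_outSum hg),
    lintegral_massLaw hf' hT μ (measurable_inSum hg)]
  have hT' : Measurable (T ∘ swapRoots) := hT.comp measurable_swapRoots
  have hTg := measurable_transportComp hT' hg
  have hcls : ∀ (G : Network Ξ) (o u : G.V),
      transportComp (transportComp (T ∘ swapRoots) g) T (cls G ![o, u]) =
        ∑' w, (∑' v, T (cls G ![v, o]) * g (cls G ![v, w])) * T (cls G ![w, u]) := by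
    intro G o u
    simp only [transportComp_cls hTg hT, transportComp_cls hT' hg, Function.comp, swapRoots_cls]
  -- The transport `f(o) ∑_{v,w} T(v, o) g(v, w) T(w, u)`: summing over `u ∈ E` removes `T(w, u)` on
  -- the outgoing side, and on the incoming side, where the roles of `o` and `u` are exchanged,
  -- removes `T(v, u)`.
  have key := hμ _ ((hf'.comp measurable_proj₁).mul (measurable_transportComp hTg hT))
  refine Eq.trans (lintegral_congr_ae ?_) (key.trans (lintegral_congr_ae ?_))
  · filter_upwards [hM] with x hx
    obtain ⟨G, o, rfl⟩ := exists_cls_one x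
    rw [cls_mem_everywhere] at hx
    simp only [inSum_cls, outSum_cls, indicator_preimage_proj₂_cls, proj₁_cls, Pi.mul_apply,
      Function.comp, hcls]
    calc f (cls G ![o]) * ∑' v, T (cls G ![v, o]) * ∑' w, g (cls G ![v, w])
        = f (cls G ![o]) * ∑' w, (∑' v, T (cls G ![v, o]) * g (cls G ![v, w])) *
            ∑' u, E.indicator 1 (cls G ![u]) * T (cls G ![w, u]) := by
          simp_rw [tsum_of_mem_markovSet (hx _), mul_one]
          rw [ENNReal.tsum_comm]
          simp_rw [ENNReal.tsum_mul_left]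
      _ = _ := by
          simp_rw [← ENNReal.tsum_mul_left]
          rw [ENNReal.tsum_comm]
          refine tsum_congr fun u => tsum_congr fun w => ?_
          ring
  · filter_upwards [hM] with x hx
    obtain ⟨G, o, rfl⟩ := exists_cls_one x
    rw [cls_mem_everywhere] at hx
    simp only [inSum_cls, indicator_preimage_proj₁_cls, proj₁_cls, Pi.mul_apply,
      Function.comp, hcls, rootInvariant_of_measurable hf G _ o]
    calc ∑' u, E.indicator 1 (cls G ![u]) * (f (cls G ![o]) *
          ∑' w, (∑' v, T (cls G ![v, u]) * g (cls G ![v, w])) * T (cls G ![w, o]))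
        = f (cls G ![o]) * ∑' w, T (cls G ![w, o]) * ∑' v, g (cls G ![v, w]) *
            ∑' u, E.indicator 1 (cls G ![u]) * T (cls G ![v, u]) := by
          simp_rw [← ENNReal.tsum_mul_left, ← ENNReal.tsum_mul_right, ← ENNReal.tsum_mul_left]
          rw [ENNReal.tsum_comm]
          refine tsum_congr fun w => ?_
          rw [ENNReal.tsum_comm]
          refine tsum_congr fun v => tsum_congr fun u => ?_
          ring
      _ = _ := by simp_rw [tsum_of_mem_markovSet (hx _), mul_one]

/-- The mass received in an invariant event is at least the probability of the event. -/
theorem MassTransportOn.le_setLIntegral_inSum {E : Set (NetStar Ξ)} {μ : Measure (NetStar Ξ)}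
    (hμ : MassTransportOn E μ) {T : NetStarStar Ξ → ℝ≥0∞} (hT : Measurable T)
    (hM : ∀ᵐ x ∂μ, x ∈ everywhere (markovSet E T)) {B : Set (NetStar Ξ)}
    (hB : MeasurableSet[invariantField Ξ] B) : μ B ≤ ∫⁻ x in B, inSum T x ∂μ := by
  rw [← lintegral_indicator_one hB.1, ← lintegral_indicator hB.1]
  have key := hμ _ (hT.indicator (measurable_proj₁ hB.1))
  have h1 : ∫⁻ x, B.indicator 1 x ∂μ =
      ∫⁻ x, outSum ((proj₂ ⁻¹' E).indicator ((proj₁ ⁻¹' B).indicator T)) x ∂μ := by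
    refine lintegral_congr_ae ?_
    filter_upwards [hM] with x hx
    obtain ⟨G, o, rfl⟩ := exists_cls_one x
    rw [cls_mem_everywhere] at hx
    simp only [outSum_cls, indicator_preimage_proj₂_cls, indicator_preimage_proj₁_cls,
      mul_left_comm _ (B.indicator 1 (cls G ![o])), ENNReal.tsum_mul_left]
    rw [tsum_of_mem_markovSet (hx o), mul_one]
  rw [h1, key]
  refine lintegral_mono fun x => ?_
  rw [← inSum_indicator_of_invariant hB]
  obtain ⟨G, o, rfl⟩ := exists_cls_one x
  -- Only senders in `E` are counted by the restricted principle, whence an inequality.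
  exact ENNReal.tsum_le_tsum fun v => indicator_le_self' (fun _ _ => zero_le) _

/-- The mass received in `E`, in an invariant event, for a unimodular network. -/
theorem MassTransportOn.setLIntegral_inSum {E : Set (NetStar Ξ)} (hE : MeasurableSet E)
    {ν : Measure (NetStar Ξ)} (hν : MassTransportOn univ ν) {T : NetStarStar Ξ → ℝ≥0∞}
    (hT : Measurable T) (hM : ∀ᵐ x ∂ν, x ∈ everywhere (markovSet E T)) {B : Set (NetStar Ξ)}
    (hB : MeasurableSet[invariantField Ξ] B) :
    ∫⁻ x in B, inSum T x ∂(ν.restrict E) = ν B := by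
  have key := hν _ (hT.indicator (measurable_proj₁ hB.1))
  simp only [preimage_univ, indicator_univ, inSum_indicator_of_invariant hB] at key
  rw [← lintegral_indicator hB.1, ← lintegral_indicator hE, ← lintegral_indicator_one hB.1]
  refine Eq.trans (lintegral_congr_ae ?_) (key.symm.trans (lintegral_congr_ae ?_))
  · filter_upwards [hM] with x hx
    obtain ⟨G, o, rfl⟩ := exists_cls_one x
    rw [cls_mem_everywhere] at hx
    by_cases hxE : cls G ![o] ∈ E
    · rw [indicator_of_mem hxE]
    · rw [indicator_of_notMem hxE]
      -- No vertex sends mass outside `E`, so restricting `ν` to `E` loses none of the received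
      -- mass.
      have : inSum T (cls G ![o]) = 0 := by
        rw [inSum_cls, ENNReal.tsum_eq_zero]
        exact fun v => eq_zero_of_mem_markovSet (hx v) hxE
      by_cases hxB : cls G ![o] ∈ B
      · rw [indicator_of_mem hxB, this]
      · rw [indicator_of_notMem hxB]
  · filter_upwards [hM] with x hx
    obtain ⟨G, o, rfl⟩ := exists_cls_one x
    rw [cls_mem_everywhere] at hx
    simp only [outSum_cls, indicator_preimage_proj₁_cls, ENNReal.tsum_mul_left]
    have := (hx o).1
    rw [outSum_cls] at this
    rw [this, mul_one]

end MassLaw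

/-! ### Weak and strong unimodularizations -/

section Unimodularization

variable {Ξ : Type u} [MetricSpace Ξ]

theorem CovariantSubset.cls_mem_event {S : CovariantSubset Ξ} {G : Network Ξ} {o : G.V} :
    cls G ![o] ∈ S.event ↔ o ∈ S.verts G := by
  refine ⟨?_, fun h => ⟨G, o, rfl, h⟩⟩
  rintro ⟨H, p, hp, h⟩
  obtain ⟨φ, hφ, hr⟩ := Quotient.exact hp
  have hr : φ.vertex p = o := hr 0
  rw [← hr]
  exact (S.covariant _ _ φ hφ p).2 h

theorem IsMarkovianInto.ae_mem_everywhere {T : NetStarStar Ξ → ℝ≥0} {μ : Measure (NetStar Ξ)}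
    {S : CovariantSubset Ξ} (h : IsMarkovianInto T μ S) :
    ∀ᵐ x ∂μ, x ∈ everywhere (markovSet S.event fun z => (T z : ℝ≥0∞)) := by
  filter_upwards [h] with x hx
  obtain ⟨G, o, rfl⟩ := exists_cls_one x
  refine cls_mem_everywhere.2 fun v => ⟨(hx G o rfl v).1, ?_⟩
  rw [outSum_cls, ENNReal.tsum_eq_zero]
  intro w
  rw [indicator_preimage_proj₂_cls]
  by_cases hw : w ∈ S.verts G
  · rw [indicator_of_notMem (not_not_intro (CovariantSubset.cls_mem_event.2 hw)), zero_mul]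
  · rw [(hx G o rfl v).2 w hw, ENNReal.coe_zero, mul_zero]

theorem IsExtension.ae_mem_event {Ξ₀ : Type w} [MetricSpace Ξ₀] {ι : Ξ₀ → Ξ}
    {μ₀ : Measure (NetStar Ξ₀)} {μ : Measure (NetStar Ξ)} {S : CovariantSubset Ξ}
    (h : IsExtension ι μ₀ μ S) : ∀ᵐ x ∂μ, x ∈ S.event := by
  filter_upwards [h.root_mem] with x hx
  obtain ⟨G, o, rfl⟩ := exists_cls_one x
  exact CovariantSubset.cls_mem_event.2 (hx G o rfl)

theorem IsProperExtension.massTransportOn {Ξ₀ : Type w} [MetricSpace Ξ₀] {ι : Ξ₀ → Ξ}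
    {μ₀ : Measure (NetStar Ξ₀)} {μ : Measure (NetStar Ξ)} {S : CovariantSubset Ξ}
    (h : IsProperExtension ι μ₀ μ S) : MassTransportOn S.event μ :=
  MassTransportOn.of_nnreal S.measurable_verts h.mass_transport

theorem unrootedLaw_apply (ν : Measure (NetStar Ξ)) {C : Set (NetClass Ξ)} (hC : MeasurableSet C) :
    unrootedLaw ν C = ν (unroot ⁻¹' C) :=
  Measure.map_apply measurable_unroot hC

theorem unrootedLaw_eq_iff {ν μ : Measure (NetStar Ξ)} : unrootedLaw ν = unrootedLaw μ ↔
    ∀ B, MeasurableSet[invariantField Ξ] B → ν B = μ B := by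
  refine ⟨fun h B hB => ?_, fun h => Measure.ext fun C hC => ?_⟩
  · obtain ⟨C, hC, rfl⟩ := exists_measurableSet_preimage_unroot hB
    rw [← unrootedLaw_apply _ hC, ← unrootedLaw_apply _ hC, h]
  · rw [unrootedLaw_apply _ hC, unrootedLaw_apply _ hC, h _ (measurableSet_preimage_unroot hC)]

theorem unrootedLaw_absolutelyContinuous_iff {ν μ : Measure (NetStar Ξ)} :
    unrootedLaw ν ≪ unrootedLaw μ ↔
      ∀ B, MeasurableSet[invariantField Ξ] B → μ B = 0 → ν B = 0 := by
  refine ⟨fun h B hB hμ => ?_, fun h => Measure.AbsolutelyContinuous.mk fun C hC hμ => ?_⟩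
  · obtain ⟨C, hC, rfl⟩ := exists_measurableSet_preimage_unroot hB
    rw [← unrootedLaw_apply _ hC] at hμ ⊢
    exact h hμ
  · rw [unrootedLaw_apply _ hC] at hμ ⊢
    exact h _ (measurableSet_preimage_unroot hC) hμ

/-- A strong unimodularization is determined by the law of the non-rooted network. -/
theorem IsStrongUnimodularization.unique {ν ν' : Measure (NetStar Ξ)} {μ₀ : Measure (NetClass Ξ)}
    (h : IsStrongUnimodularization ν μ₀) (h' : IsStrongUnimodularization ν' μ₀) : ν = ν' := by
  have := h.prob
  have := h'.prob
  refine MassTransportOn.eq_of_eq_on_invariantField MeasurableSet.univ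
    (massTransportOn_univ_iff.2 h.unimodular) (massTransportOn_univ_iff.2 h'.unimodular)
    (by simp) (by simp) (unrootedLaw_eq_iff.1 (h.law_eq.trans h'.law_eq.symm))

theorem isWeakUnimodularization_massLaw {E : Set (NetStar Ξ)} {μ : Measure (NetStar Ξ)}
    [IsProbabilityMeasure μ] (hμ : MassTransportOn E μ) {T : NetStarStar Ξ → ℝ≥0∞}
    (hT : Measurable T) (hM : ∀ᵐ x ∂μ, x ∈ everywhere (markovSet E T))
    (hfin : ∫⁻ x, inSum T x ∂μ < ⊤) :
    IsWeakUnimodularization (massLaw (fun _ => (∫⁻ x, inSum T x ∂μ)⁻¹) T μ) (unrootedLaw μ) := by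
  have hpos : ∫⁻ x, inSum T x ∂μ ≠ 0 := by
    have := hμ.le_setLIntegral_inSum hT hM (@MeasurableSet.univ _ (invariantField Ξ))
    rw [measure_univ, setLIntegral_univ] at this
    exact (zero_lt_one.trans_le this).ne'
  have happ : ∀ B, MeasurableSet[invariantField Ξ] B →
      massLaw (fun _ => (∫⁻ x, inSum T x ∂μ)⁻¹) T μ B =
        (∫⁻ x, inSum T x ∂μ)⁻¹ * ∫⁻ x in B, inSum T x ∂μ := by
    intro B hB
    rw [massLaw_apply_of_invariant measurable_const hT μ hB, ← lintegral_indicator hB.1,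
      ← lintegral_const_mul _ ((measurable_inSum hT).indicator hB.1)]
    refine lintegral_congr fun x => ?_
    by_cases hx : x ∈ B <;> simp [hx]
  refine ⟨⟨?_⟩, massTransportOn_univ_iff.1 (hμ.massLaw hT hM measurable_const), ?_, ?_⟩
  · rw [happ _ (@MeasurableSet.univ _ (invariantField Ξ)), setLIntegral_univ,
      ENNReal.inv_mul_cancel hpos hfin.ne]
  · rw [unrootedLaw_absolutelyContinuous_iff]
    intro B hB h0
    rw [happ B hB, Measure.restrict_eq_zero.2 h0, lintegral_zero_measure, mul_zero]
  · rw [unrootedLaw_absolutelyContinuous_iff]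
    intro B hB h0
    rw [happ B hB, mul_eq_zero, ENNReal.inv_eq_zero] at h0
    have h1 := h0.resolve_left hfin.ne
    exact le_antisymm (h1 ▸ hμ.le_setLIntegral_inSum hT hM hB) zero_le

theorem isStrongUnimodularization_massLaw {E : Set (NetStar Ξ)} {μ : Measure (NetStar Ξ)}
    [IsProbabilityMeasure μ] (hμ : MassTransportOn E μ) {T : NetStarStar Ξ → ℝ≥0∞}
    (hT : Measurable T) (hM : ∀ᵐ x ∂μ, x ∈ everywhere (markovSet E T))
    (hfin : ∀ᵐ x ∂μ, condLExp (invariantField Ξ) μ (inSum T) x < ⊤) :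
    IsStrongUnimodularization
      (massLaw (fun x => (condLExp (invariantField Ξ) μ (inSum T) x)⁻¹) T μ) (unrootedLaw μ) := by
  set C := condLExp (invariantField Ξ) μ (inSum T)
  have hCI : Measurable[invariantField Ξ] C := measurable_condLExp _ _ _
  have hC : Measurable C := hCI.mono (invariantField_le Ξ) le_rfl
  have hCinv : Measurable[invariantField Ξ] fun x => (C x)⁻¹ := hCI.inv
  -- On the invariant event `{C = 0}` the received mass has integral zero, yet it dominates the
  -- probability of that event.
  have hpos : ∀ᵐ x ∂μ, C x ≠ 0 := by
    have h0 : MeasurableSet[invariantField Ξ] {x | C x = 0} := hCI (measurableSet_singleton 0)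
    have h1 := hμ.le_setLIntegral_inSum hT hM h0
    rw [← setLIntegral_condLExp (invariantField_le Ξ) μ _ h0,
      setLIntegral_congr_fun (g := 0) h0.1 fun x hx => hx] at h1
    simp only [Pi.zero_apply, lintegral_zero, nonpos_iff_eq_zero] at h1
    exact measure_eq_zero_iff_ae_notMem.1 h1
  have happ : ∀ B, MeasurableSet[invariantField Ξ] B → massLaw (fun x => (C x)⁻¹) T μ B = μ B := by
    intro B hB
    rw [massLaw_apply_of_invariant (hCinv.mono (invariantField_le Ξ) le_rfl) hT μ hB,
      ← lintegral_mul_condLExp (invariantField_le Ξ) μ (hCinv.indicator hB) (measurable_inSum hT),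
      ← lintegral_indicator_one hB.1]
    refine lintegral_congr_ae ?_
    filter_upwards [hpos, hfin] with x hx hx'
    by_cases hxB : x ∈ B
    · simp only [indicator_of_mem hxB, Pi.one_apply]
      exact ENNReal.inv_mul_cancel hx hx'.ne
    · simp [hxB]
  refine ⟨⟨?_⟩, massTransportOn_univ_iff.1 (hμ.massLaw hT hM hCinv), unrootedLaw_eq_iff.2 happ⟩
  rw [happ _ (@MeasurableSet.univ _ (invariantField Ξ)), measure_univ]

theorem condLExp_inSum_lt_top {E : Set (NetStar Ξ)} (hE : MeasurableSet E)
    {μ ν : Measure (NetStar Ξ)} [IsProbabilityMeasure μ] [IsProbabilityMeasure ν]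
    (hμ : MassTransportOn E μ) (hμE : ∀ᵐ x ∂μ, x ∈ E) {T : NetStarStar Ξ → ℝ≥0∞}
    (hT : Measurable T) (hM : ∀ᵐ x ∂μ, x ∈ everywhere (markovSet E T))
    (hν : MassTransportOn univ ν) (hνμ : unrootedLaw ν ≪ unrootedLaw μ)
    (hμν : unrootedLaw μ ≪ unrootedLaw ν) :
    ∀ᵐ x ∂μ, condLExp (invariantField Ξ) μ (inSum T) x < ⊤ := by
  rw [unrootedLaw_absolutelyContinuous_iff] at hνμ hμν
  have hle := invariantField_le Ξ
  have hev := measurableSet_everywhere (measurableSet_markovSet hE hT)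
  have hMν : ∀ᵐ x ∂ν, x ∈ everywhere (markovSet E T) := hνμ _ hev.compl hM
  have hlam := fun B hB => hν.setLIntegral_inSum hE hT hMν (B := B) hB
  set lam := ν.restrict E
  -- The density is taken on `I` only, where absolute continuity is known; the uniqueness theorem
  -- then extends it to all events.
  have hac : lam.trim hle ≪ μ.trim hle := by
    refine Measure.AbsolutelyContinuous.mk fun B hB h0 => ?_
    rw [trim_measurableSet_eq hle hB] at h0 ⊢
    exact le_antisymm ((Measure.restrict_apply_le E B).trans_eq (hνμ B hB h0)) zero_le
  set k := (lam.trim hle).rnDeriv (μ.trim hle)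
  have hkI : Measurable[invariantField Ξ] k := Measure.measurable_rnDeriv _ _
  have hk : Measurable k := hkI.mono hle le_rfl
  have hkB : ∀ B, MeasurableSet[invariantField Ξ] B → μ.withDensity k B = lam B := by
    intro B hB
    rw [withDensity_apply _ hB.1, ← setLIntegral_trim hle hkI hB,
      Measure.setLIntegral_rnDeriv hac, trim_measurableSet_eq hle hB]
  have : IsFiniteMeasure (μ.withDensity k) :=
    ⟨by rw [hkB _ (@MeasurableSet.univ _ (invariantField Ξ))]; exact measure_lt_top _ _⟩
  have hlameq : lam = μ.withDensity k :=
    MassTransportOn.eq_of_eq_on_invariantField hE (hν.restrict hE) (hμ.withDensity hE hkI)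
      (ae_restrict_mem hE) ((withDensity_absolutelyContinuous μ k).ae_le hμE)
      fun B hB => (hkB B hB).symm
  have hint : ∫⁻ x, k x * condLExp (invariantField Ξ) μ (inSum T) x ∂μ ≠ ⊤ := by
    rw [lintegral_mul_condLExp hle μ hkI (measurable_inSum hT)]
    have h1 := hlam _ (@MeasurableSet.univ _ (invariantField Ξ))
    rw [setLIntegral_univ, hlameq, lintegral_withDensity_eq_lintegral_mul _ hk
      (measurable_inSum hT)] at h1
    simp only [Pi.mul_apply] at h1
    rw [h1]
    exact measure_ne_top _ _
  -- On `{k = 0}` the measure `lam` vanishes. By `hlam` the `ν`-probability of this event is the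
  -- mass received there under `lam`, so it is zero, and `μ` inherits this.
  have hk0 : ∀ᵐ x ∂μ, k x ≠ 0 := by
    have h0 : MeasurableSet[invariantField Ξ] {x | k x = 0} := hkI (measurableSet_singleton 0)
    refine measure_eq_zero_iff_ae_notMem.1 (hμν {x | k x = 0} h0 ?_)
    rw [← hlam _ h0, Measure.restrict_eq_zero.2, lintegral_zero_measure]
    rw [← hkB _ h0, withDensity_apply _ h0.1, setLIntegral_congr_fun (g := 0) h0.1 fun x hx => hx]
    simp
  filter_upwards [hk0, ae_lt_top (hk.mul (measurable_condLExp' _ _ _)) hint] with x hx hx'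
  rw [lt_top_iff_ne_top]
  intro h
  rw [Pi.mul_apply, h, ENNReal.mul_top hx] at hx'
  exact lt_irrefl _ hx'

end Unimodularization

end RandomNetwork

end

theorem mainTheorem6 {Ξ₀ : Type*} {Ξ : Type*}
    [MetricSpace Ξ₀] [CompleteSpace Ξ₀] [TopologicalSpace.SeparableSpace Ξ₀]
    [MetricSpace Ξ] [CompleteSpace Ξ] [TopologicalSpace.SeparableSpace Ξ]
    (ι : Ξ₀ → Ξ) (hι : Isometry ι)
    (μ₀ : MeasureTheory.Measure (RandomNetwork.NetStar Ξ₀))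
    [MeasureTheory.IsProbabilityMeasure μ₀] (hμ₀ : RandomNetwork.Unimodular μ₀)
    (μ : MeasureTheory.Measure (RandomNetwork.NetStar Ξ))
    [MeasureTheory.IsProbabilityMeasure μ]
    (S : RandomNetwork.CovariantSubset Ξ)
    (hS : RandomNetwork.IsProperExtension ι μ₀ μ S)
    (T : RandomNetwork.NetStarStar Ξ → NNReal) (hT : Measurable T)
    (hTS : RandomNetwork.IsMarkovianInto T μ S) :
    (RandomNetwork.CanBeUnimodularized (RandomNetwork.unrootedLaw μ) ↔
      ∀ᵐ x ∂μ, RandomNetwork.condReceivedMass T μ x < ⊤) ∧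
    (∫⁻ x, RandomNetwork.receivedMass T x ∂μ < ⊤ →
      ∃ ν : MeasureTheory.Measure (RandomNetwork.NetStar Ξ),
        (∀ A, MeasurableSet A → ν A = RandomNetwork.weakFormula T μ A) ∧
        RandomNetwork.IsWeakUnimodularization ν (RandomNetwork.unrootedLaw μ)) ∧
    ((∀ᵐ x ∂μ, RandomNetwork.condReceivedMass T μ x < ⊤) →
      ∃ ν : MeasureTheory.Measure (RandomNetwork.NetStar Ξ),
        (∀ A, MeasurableSet A → ν A = RandomNetwork.strongFormula T μ A) ∧
        RandomNetwork.IsStrongUnimodularization ν (RandomNetwork.unrootedLaw μ) ∧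
        ∀ ν' : MeasureTheory.Measure (RandomNetwork.NetStar Ξ),
          RandomNetwork.IsStrongUnimodularization ν' (RandomNetwork.unrootedLaw μ) → ν' = ν) := by

  have hT' : Measurable fun z => (T z : ENNReal) := hT.coe_nnreal_ennreal
  have hM := hTS.ae_mem_everywhere
  have hmt := hS.massTransportOn
  have hstrong := fun hfin => RandomNetwork.isStrongUnimodularization_massLaw hmt hT' hM hfin
  refine ⟨⟨?_, fun hfin => ⟨_, Or.inr (hstrong hfin)⟩⟩, fun hfin => ?_, fun hfin => ?_⟩
  -- Equality of the non-rooted laws is a case of mutual absolute continuity, so both kinds of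
  -- unimodularization fall under the same lemma.
  · rintro ⟨ν, hν | hν⟩
    · have := hν.prob
      exact RandomNetwork.condLExp_inSum_lt_top S.measurable_verts hmt hS.ae_mem_event hT' hM
        (RandomNetwork.massTransportOn_univ_iff.2 hν.unimodular) hν.abs_cont hν.abs_cont'
    · have := hν.prob
      exact RandomNetwork.condLExp_inSum_lt_top S.measurable_verts hmt hS.ae_mem_event hT' hM
        (RandomNetwork.massTransportOn_univ_iff.2 hν.unimodular) hν.law_eq.absolutelyContinuous
        hν.law_eq.symm.absolutelyContinuous
  · refine ⟨_, fun A hA => ?_, RandomNetwork.isWeakUnimodularization_massLaw hmt hT' hM hfin⟩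
    rw [RandomNetwork.massLaw_apply measurable_const hT' μ hA, RandomNetwork.weakFormula,
      MeasureTheory.lintegral_const_mul _ (RandomNetwork.measurable_inSum
        (hT'.indicator (RandomNetwork.measurable_proj₁ hA)))]
    rfl
  · exact ⟨_, fun A hA => RandomNetwork.massLaw_apply
      (MeasureTheory.measurable_condLExp' _ _ _).inv hT' μ hA, hstrong hfin,
      fun ν' hν' => hν'.unique (hstrong hfin)⟩
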